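/- **Theorem.** Work in continuous logic for many-sorted bounded metric structures: a metric language $\mathcal L$ has sorts $S$ with bounds $B_S$, function symbols and relation symbols (with values in compact intervals) with prescribed moduli of uniform continuity; an $\mathcal L$-structure interprets each sort as a nonempty complete metric space of diameter at most $B_S$; formulas are built from atomic formulas (including the metrics) using continuous functions $g:\mathbb R^n\to\mathbb R$ and the quantifiers $\sup_{x\in S}$, $\inf_{x\in S}$. A theory is a set $\mathrm T$ of sentences that has a model, where $M\models \mathrm T$ means $\phi^M=0$ for all $\phi\in \mathrm T$; it is complete if for any two of its models $M,N$ the same sentences $\phi$ satisfy $\phi^M=0$ and $\phi^N=0$. For a finite tuple of variables $\bar x$ the formulas $\phi(\bar x)$ carry the seminorm $\|\phi\|_{\mathrm T}=\sup\{|\phi^M(\bar a)| : M\models \mathrm T,\ \bar a\in M\}$; $\mathcal L$ is separable relative to $\mathrm T$ if the sum, over all finite tuples of sorts, of the density characters of these spaces of formulas is at most $\aleph_0$. A definable predicate is an element of the completion of such a space (evaluated in models of $\mathrm T$ by taking limits). A definable set $X$ relative to $\mathrm T$ assigns to each $M\models \mathrm T$ a closed subset $X(M)$ of a fixed finite product of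 sorts of $M$, with $\rho(X(N))\subseteq X(M)$ for every elementary embedding $\rho:N\to M$ of models of $\mathrm T$, such that some definable predicate $P$ satisfies $P^M(\bar a)=d(\bar a,X(M))$ for all $M\models \mathrm T$ and $\bar a\in M$. Let $\mathrm T$ be a complete $\mathcal L$-theory such that $\mathcal L$ is separable relative to $\mathrm T$. Suppose that there are a definable set $X$ relative to $\mathrm T$ and a formula, or more generally a definable predicate, $\phi(\bar x,\bar y)$ ($\bar x,\bar y$ of the sorts of $X$) such that for every $M\models \mathrm T$: 1. $\phi^M(\bar a,\bar b)\in\{0,1\}$ for all $\bar a,\bar b\in X(M)$; 2. for all $\bar a,\bar b\in X(M)$, if $\phi^M(\bar a,\bar b)=0$ then $\phi^M(\bar b,\bar a)=1$; 3. for every $n<\omega$ and all $\bar a_0,\dots,\bar a_{n-1}\in X(M)$ there is $\bar b\in X(M)$ with $\phi^M(\bar a_i,\bar b)=0$ for all $i<n$. If the Continuum Hypothesis fails, then there are models $A,B\models \mathrm T$ with density characters at most $\mathfrak c$ (the density character of a structure is the supremum of those of its sorts) such that the metric ultrapowers $A^{\mathcal U}$ and $B^{\mathcal V}$ are not isomorphic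 for all nonprincipal ultrafilters $\mathcal U,\mathcal V$ on $\omega$. -/

import Mathlib

open Filter Topology
open scoped NNReal ENNReal Cardinal

universe u v w

noncomputable section

/-- A (many-sorted) metric language. Constant symbols are the function symbols of arity `0`.
The metric symbol `d_S : S × S → [0, B_S]` of each sort is not listed among the relation symbols: it
is built into structures, atomic formulas and embeddings below. -/
structure MetricLanguage : Type (u + 1) where
  /-- sorts -/
  Sorts : Type u
  /-- the bound `B_S` on the diameter of the sort `S` -/
  bound : Sorts → ℝ≥0
  /-- function symbols, with domain, co-domain and modulus of uniform continuity -/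
  Functions : Type u
  funArity : Functions → ℕ
  funDom : ∀ f : Functions, Fin (funArity f) → Sorts
  funCod : Functions → Sorts
  funMod : Functions → Set.Ioc (0 : ℝ) 1 → Set.Ioc (0 : ℝ) 1
  /-- relation symbols, with domain, value interval `[relLo, relHi]` and modulus -/
  Relations : Type u
  relArity : Relations → ℕ
  relDom : ∀ R : Relations, Fin (relArity R) → Sorts
  relLo : Relations → ℝ
  relHi : Relations → ℝ
  relLo_le_relHi : ∀ R, relLo R ≤ relHi R
  relMod : Relations → Set.Ioc (0 : ℝ) 1 → Set.Ioc (0 : ℝ) 1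

namespace MetricLanguage

/-- A metric structure: nonempty complete bounded metric spaces, with uniformly continuous
interpretations of the symbols obeying the prescribed moduli. -/
structure Struc (L : MetricLanguage.{u}) : Type (max u (w + 1)) where
  carrier : L.Sorts → Type w
  metric : ∀ S, MetricSpace (carrier S)
  complete : ∀ S, CompleteSpace (carrier S)
  nonempty : ∀ S, Nonempty (carrier S)
  dist_le : ∀ S (a b : carrier S), dist a b ≤ L.bound S
  funMap : ∀ f : L.Functions, (∀ i, carrier (L.funDom f i)) → carrier (L.funCod f)
  funMap_unif : ∀ (f : L.Functions) (ε : Set.Ioc (0 : ℝ) 1) (a b : ∀ i, carrier (L.funDom f i)),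
    (∀ i, dist (a i) (b i) < (L.funMod f ε : ℝ)) → dist (funMap f a) (funMap f b) ≤ (ε : ℝ)
  relMap : ∀ R : L.Relations, (∀ i, carrier (L.relDom R i)) → ℝ
  relMap_mem : ∀ R a, relMap R a ∈ Set.Icc (L.relLo R) (L.relHi R)
  relMap_unif : ∀ (R : L.Relations) (ε : Set.Ioc (0 : ℝ) 1) (a b : ∀ i, carrier (L.relDom R i)),
    (∀ i, dist (a i) (b i) < (L.relMod R ε : ℝ)) → |relMap R a - relMap R b| ≤ (ε : ℝ)

attribute [instance] Struc.metric Struc.complete Struc.nonempty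

variable {L : MetricLanguage.{u}}

/-! ### Terms and formulas -/

/-- Terms in the variables `i : β`, the variable `i` having the sort `τ i`, indexed by co-domain. -/
inductive Term (L : MetricLanguage.{u}) {β : Type} (τ : β → L.Sorts) : L.Sorts → Type u
  | var (i : β) : Term L τ (τ i)
  | func (f : L.Functions) (ts : ∀ i, Term L τ (L.funDom f i)) : Term L τ (L.funCod f)

/-- The value of a term in a structure. -/
def Term.eval (M : Struc.{u, w} L) {β : Type} {τ : β → L.Sorts} (v : ∀ i, M.carrier (τ i)) :
    ∀ {S : L.Sorts}, Term L τ S → M.carrier S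
  | _, .var i => v i
  | _, .func f ts => M.funMap f fun i => (ts i).eval M v

/-- Formulas whose free variables are the `i : α`, of sort `σ i`, together with a list of
variables of sorts `l` which are available for quantification. -/
inductive BFormula (L : MetricLanguage.{u}) {α : Type} (σ : α → L.Sorts) : List L.Sorts → Type u
  | dist {l : List L.Sorts} (S : L.Sorts) (s t : Term L (Sum.elim σ l.get) S) : BFormula L σ l
  | rel {l : List L.Sorts} (R : L.Relations)
      (ts : ∀ i, Term L (Sum.elim σ l.get) (L.relDom R i)) : BFormula L σ l
  | conn {l : List L.Sorts} (n : ℕ) (g : C(Fin n → ℝ, ℝ)) (φ : Fin n → BFormula L σ l) :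
      BFormula L σ l
  | sup {l : List L.Sorts} (S : L.Sorts) (φ : BFormula L σ (S :: l)) : BFormula L σ l
  | inf {l : List L.Sorts} (S : L.Sorts) (φ : BFormula L σ (S :: l)) : BFormula L σ l

/-- Joins the values of the free variables and those of the bound variables. -/
def joinEnv (M : Struc.{u, w} L) {α : Type} {σ : α → L.Sorts} {l : List L.Sorts}
    (v : ∀ i, M.carrier (σ i)) (x : ∀ i, M.carrier (l.get i)) :
    ∀ i, M.carrier (Sum.elim σ l.get i)
  | .inl i => v i
  | .inr i => x i

/-- Extends an assignment of the bound variables by one value. -/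
def consEnv (M : Struc.{u, w} L) {S : L.Sorts} {l : List L.Sorts} (b : M.carrier S)
    (x : ∀ i, M.carrier (l.get i)) : ∀ i, M.carrier ((S :: l).get i)
  | ⟨0, _⟩ => b
  | ⟨i + 1, h⟩ => x ⟨i, Nat.lt_of_succ_lt_succ h⟩

/-- The value of a formula in a structure. -/
def BFormula.eval (M : Struc.{u, w} L) {α : Type} {σ : α → L.Sorts} (v : ∀ i, M.carrier (σ i)) :
    ∀ {l : List L.Sorts}, BFormula L σ l → (∀ i, M.carrier (l.get i)) → ℝ
  | _, .dist _ s t, x => Dist.dist (s.eval M (joinEnv M v x)) (t.eval M (joinEnv M v x))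
  | _, .rel R ts, x => M.relMap R fun i => (ts i).eval M (joinEnv M v x)
  | _, .conn _ g φ, x => g fun i => (φ i).eval M v x
  | _, .sup S φ, x => ⨆ b : M.carrier S, φ.eval M v (consEnv M b x)
  | _, .inf S φ, x => ⨅ b : M.carrier S, φ.eval M v (consEnv M b x)

/-- The set `Form_{x̄}(L)` of formulas with free variables among the `i : α`, of sorts `σ i`. -/
abbrev Formula (L : MetricLanguage.{u}) {α : Type} (σ : α → L.Sorts) : Type u := BFormula L σ []

def Formula.eval {α : Type} {σ : α → L.Sorts} (φ : L.Formula σ) (M : Struc.{u, w} L)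
    (a : ∀ i, M.carrier (σ i)) : ℝ :=
  BFormula.eval M a φ fun i => i.elim0

/-- The formula `φ - ψ`. -/
def Formula.sub {α : Type} {σ : α → L.Sorts} (φ ψ : L.Formula σ) : L.Formula σ :=
  .conn 2 ⟨fun r => r 0 - r 1, by fun_prop⟩ ![φ, ψ]

theorem Formula.eval_sub {α : Type} {σ : α → L.Sorts} (φ ψ : L.Formula σ) (M : Struc.{u, w} L)
    (a : ∀ i, M.carrier (σ i)) : (φ.sub ψ).eval M a = φ.eval M a - ψ.eval M a := by
  simp [Formula.eval, Formula.sub, BFormula.eval]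

/-- Sentences: formulas without free variables. -/
abbrev Sentence (L : MetricLanguage.{u}) : Type u := L.Formula (Empty.elim : Empty → L.Sorts)

def Sentence.value (φ : L.Sentence) (M : Struc.{u, w} L) : ℝ :=
  Formula.eval φ M fun i => i.elim

/-! ### Embeddings, isomorphisms, elementary embeddings -/

structure Embedding (N M : Struc.{u, w} L) where
  toFun : ∀ S, N.carrier S → M.carrier S
  map_dist : ∀ S (a b : N.carrier S), dist (toFun S a) (toFun S b) = dist a b
  map_fun : ∀ (f : L.Functions) (a : ∀ i, N.carrier (L.funDom f i)),
    toFun _ (N.funMap f a) = M.funMap f fun i => toFun _ (a i)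
  map_rel : ∀ (R : L.Relations) (a : ∀ i, N.carrier (L.relDom R i)),
    N.relMap R a = M.relMap R fun i => toFun _ (a i)

def Embedding.IsIsomorphism {N M : Struc.{u, w} L} (ρ : Embedding N M) : Prop :=
  ∀ S, Function.Surjective (ρ.toFun S)

def Isomorphic (N M : Struc.{u, w} L) : Prop := ∃ ρ : Embedding N M, ρ.IsIsomorphism

def Embedding.IsElementary {N M : Struc.{u, w} L} (ρ : Embedding N M) : Prop :=
  ∀ (n : ℕ) (σ : Fin n → L.Sorts) (φ : L.Formula σ) (a : ∀ i, N.carrier (σ i)),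
    φ.eval N a = φ.eval M fun i => ρ.toFun _ (a i)

/-! ### Theories -/

/-- `M ⊨ T`. -/
def Models (M : Struc.{u, w} L) (T : Set L.Sentence) : Prop := ∀ φ ∈ T, Sentence.value φ M = 0

/-- The models of `T`. -/
abbrev Mod (T : Set L.Sentence) : Type (u + 1) := {M : Struc.{u, u} L // Models M T}

/-- A set of sentences is a theory if it has a model. -/
def IsTheory (T : Set L.Sentence) : Prop := Nonempty (Mod T)

/-- The theory `Th(M)` of a structure. -/
def Th (M : Struc.{u, w} L) : Set L.Sentence := {φ | Sentence.value φ M = 0}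

/-- Any two models are elementarily equivalent. -/
def IsComplete (T : Set L.Sentence) : Prop := ∀ M N : Mod T, Th M.1 = Th N.1

/-! ### Density characters -/

/-- The smallest cardinality of a dense subset. -/
def densityCharacter (X : Type w) [TopologicalSpace X] : Cardinal.{w} :=
  ⨅ D : {D : Set X // Dense D}, #D.1

/-- The density character of a structure: the supremum over the sorts. -/
def Struc.densityCharacter (M : Struc.{u, u} L) : Cardinal.{u} :=
  ⨆ S, MetricLanguage.densityCharacter (M.carrier S)

/-- The semi-norm `‖φ‖_T = sup {|φ^M(ā)| : M ⊨ T, ā ∈ M}`. -/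
def theoryNorm (T : Set L.Sentence) {α : Type} {σ : α → L.Sorts} (φ : L.Formula σ) : ℝ≥0∞ :=
  ⨆ (M : Mod T) (a : ∀ i, M.1.carrier (σ i)), ‖φ.eval M.1 a‖ₑ

/-- The set of formulas in given variables, equipped with the semi-norm of `T`. -/
structure FormulaSpace (T : Set L.Sentence) {α : Type} (σ : α → L.Sorts) : Type u where
  formula : L.Formula σ

theorem theoryNorm_sub (T : Set L.Sentence) {α : Type} {σ : α → L.Sorts} (φ ψ : L.Formula σ) :
    theoryNorm T (φ.sub ψ) =
      ⨆ (M : Mod T) (a : ∀ i, M.1.carrier (σ i)), edist (φ.eval M.1 a) (ψ.eval M.1 a) := by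
  simp only [theoryNorm, Formula.eval_sub, edist_eq_enorm_sub]

instance (T : Set L.Sentence) {α : Type} (σ : α → L.Sorts) :
    PseudoEMetricSpace (FormulaSpace T σ) where
  edist φ ψ := theoryNorm T (φ.formula.sub ψ.formula)
  edist_self φ := by simp [theoryNorm_sub]
  edist_comm φ ψ := by simp [theoryNorm_sub, edist_comm]
  edist_triangle φ ψ χ := by
    simp only [theoryNorm_sub]
    refine iSup₂_le fun M a => (edist_triangle _ (ψ.formula.eval M.1 a) _).trans ?_
    exact add_le_add (le_iSup₂ (f := fun (M : Mod T) (a : ∀ i, M.1.carrier (σ i)) =>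
        edist (φ.formula.eval M.1 a) (ψ.formula.eval M.1 a)) M a)
      (le_iSup₂ (f := fun (M : Mod T) (a : ∀ i, M.1.carrier (σ i)) =>
        edist (ψ.formula.eval M.1 a) (χ.formula.eval M.1 a)) M a)

/-- `χ(L, T)`: the sum, over all finite tuples of sorts, of the density characters of the spaces of
formulas in variables of these sorts. -/
def languageDensityCharacter (T : Set L.Sentence) : Cardinal.{u} :=
  Cardinal.sum fun x : (Σ n : ℕ, Fin n → L.Sorts) => densityCharacter (FormulaSpace T x.2)

/-- The language is separable relative to `T`. -/
def SeparableRelativeTo (T : Set L.Sentence) : Prop := languageDensityCharacter T ≤ ℵ₀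

/-! ### Definable predicates and definable sets -/

/-- Definable predicates: the completion of the space of formulas. -/
abbrev DefinablePredicate (T : Set L.Sentence) {α : Type} (σ : α → L.Sorts) : Type u :=
  UniformSpace.Completion (FormulaSpace T σ)

theorem uniformContinuous_eval (T : Set L.Sentence) {α : Type} {σ : α → L.Sorts} (M : Mod T)
    (a : ∀ i, M.1.carrier (σ i)) :
    UniformContinuous fun φ : FormulaSpace T σ => φ.formula.eval M.1 a := by
  have h : LipschitzWith 1 fun φ : FormulaSpace T σ => φ.formula.eval M.1 a := by
    intro φ ψ
    have : edist φ ψ = theoryNorm T (φ.formula.sub ψ.formula) := rfl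
    rw [this, theoryNorm_sub, ENNReal.coe_one, one_mul]
    exact le_iSup₂ (f := fun (M : Mod T) (a : ∀ i, M.1.carrier (σ i)) =>
        edist (φ.formula.eval M.1 a) (ψ.formula.eval M.1 a)) M a
  exact h.uniformContinuous

/-- The value of a definable predicate in a model of `T`: the continuous extension of the value of
formulas. -/
def DefinablePredicate.eval {T : Set L.Sentence} {α : Type} {σ : α → L.Sorts}
    (P : DefinablePredicate T σ) (M : Mod T) (a : ∀ i, M.1.carrier (σ i)) : ℝ :=
  UniformSpace.Completion.extension (fun φ : FormulaSpace T σ => φ.formula.eval M.1 a) P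

theorem DefinablePredicate.eval_coe {T : Set L.Sentence} {α : Type} {σ : α → L.Sorts}
    (φ : FormulaSpace T σ) (M : Mod T) (a : ∀ i, M.1.carrier (σ i)) :
    DefinablePredicate.eval (φ : DefinablePredicate T σ) M a = φ.formula.eval M.1 a :=
  UniformSpace.Completion.extension_coe (uniformContinuous_eval T M a) φ

/-- A uniform assignment relative to `T`: a choice, for every model `M` of `T`, of a closed subset
of a fixed finite product of sorts of `M`, preserved by elementary embeddings. -/
structure UniformAssignment (T : Set L.Sentence) where
  n : ℕ
  sorts : Fin n → L.Sorts
  set : ∀ M : Mod T, Set (∀ i, M.1.carrier (sorts i))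
  isClosed : ∀ M, IsClosed (set M)
  map_mem : ∀ (N M : Mod T) (ρ : Embedding N.1 M.1), ρ.IsElementary →
    ∀ a ∈ set N, (fun i => ρ.toFun _ (a i)) ∈ set M

/-- A uniform assignment `X` is a definable set if the distance to `X(M)`, for the maximum metric
on tuples, is given by a definable predicate. -/
def UniformAssignment.IsDefinable {T : Set L.Sentence} (X : UniformAssignment T) : Prop :=
  ∃ P : DefinablePredicate T X.sorts, ∀ (M : Mod T) (a : ∀ i, M.1.carrier (X.sorts i)),
    P.eval M a = Metric.infDist a (X.set M)

/-- The pair `(x̄, ȳ)` as an assignment of the concatenated tuple of variables. -/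
def pairEnv {M : Struc.{u, w} L} {n : ℕ} {σ : Fin n → L.Sorts} (a b : ∀ i, M.carrier (σ i)) :
    ∀ i : Fin n ⊕ Fin n, M.carrier (Sum.elim σ σ i)
  | .inl i => a i
  | .inr i => b i

/-! ### Ultraproducts -/

section Ultraproduct

variable {I : Type v}

/-- The `U`-limit of a family of reals. -/
def ulim (U : Ultrafilter I) (x : I → ℝ) : ℝ := limUnder (U : Filter I) x

theorem tendsto_ulim (U : Ultrafilter I) {x : I → ℝ} {a b : ℝ} (h : ∀ i, x i ∈ Set.Icc a b) :
    Tendsto x U (𝓝 (ulim U x)) := by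
  obtain ⟨r, -, hr⟩ := isCompact_Icc.ultrafilter_le_nhds' (U.map x)
    (show ∀ᶠ i in (U : Filter I), x i ∈ Set.Icc a b from Eventually.of_forall h)
  exact tendsto_nhds_limUnder ⟨r, hr⟩

theorem ulim_eq (U : Ultrafilter I) {x : I → ℝ} {r : ℝ} (h : Tendsto x U (𝓝 r)) : ulim U x = r :=
  h.limUnder_eq

/-- The product of the sorts `S` of the structures, with the pseudo-metric given by `U`. -/
structure PreUltra (M : I → Struc.{u, w} L) (U : Ultrafilter I) (S : L.Sorts) : Type (max v w) where
  val : ∀ i, (M i).carrier S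

variable (M : I → Struc.{u, w} L) (U : Ultrafilter I)

theorem tendsto_dist (S : L.Sorts) (a b : ∀ i, (M i).carrier S) :
    Tendsto (fun i => dist (a i) (b i)) U (𝓝 (ulim U fun i => dist (a i) (b i))) :=
  tendsto_ulim U fun i => ⟨dist_nonneg, (M i).dist_le S (a i) (b i)⟩

instance (S : L.Sorts) : PseudoMetricSpace (PreUltra M U S) where
  dist a b := ulim U fun i => dist (a.val i) (b.val i)
  dist_self a := ulim_eq U (by simp)
  dist_comm a b := by simp only [dist_comm]
  dist_triangle a b c :=
    le_of_tendsto_of_tendsto' (tendsto_dist M U S a.val c.val)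
      ((tendsto_dist M U S a.val b.val).add (tendsto_dist M U S b.val c.val)) fun i => dist_triangle _ _ _

theorem PreUltra.dist_def (S : L.Sorts) (a b : PreUltra M U S) :
    dist a b = ulim U fun i => dist (a.val i) (b.val i) := rfl

theorem PreUltra.tendsto_dist (S : L.Sorts) (a b : PreUltra M U S) :
    Tendsto (fun i => dist (a.val i) (b.val i)) U (𝓝 (dist a b)) :=
  MetricLanguage.tendsto_dist M U S a.val b.val

instance (S : L.Sorts) : CompleteSpace (PreUltra M U S) := by
  classical
  refine Metric.complete_of_convergent_controlled_sequences (fun n => (1 / 2 : ℝ) ^ n)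
    (fun n => by positivity) fun a ha => ?_
  let A : ℕ → Set I := fun k => {i | dist ((a k).val i) ((a (k + 1)).val i) < (1 / 2 : ℝ) ^ k}
  have hA : ∀ k, A k ∈ U := fun k =>
    (PreUltra.tendsto_dist M U S (a k) (a (k + 1))).eventually_lt_const
      (ha k k (k + 1) le_rfl (Nat.le_succ k))
  let B : ℕ → Set I := fun k => {i | ∀ j < k, i ∈ A j}
  have hB : ∀ k, B k ∈ U := by
    intro k
    have : ∀ᶠ i in (U : Filter I), ∀ j ∈ Set.Iio k, i ∈ A j :=
      (eventually_all_finite (Set.finite_Iio k)).2 fun j _ => hA j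
    exact this
  let b : ℕ → ∀ i, (M i).carrier S := fun k i =>
    Nat.rec ((a 0).val i) (fun k c => if i ∈ B (k + 1) then (a (k + 1)).val i else c) k
  have hb0 : ∀ i, b 0 i = (a 0).val i := fun i => rfl
  have hbs : ∀ k i, b (k + 1) i = if i ∈ B (k + 1) then (a (k + 1)).val i else b k i := fun k i => rfl
  have hba : ∀ k, ∀ i ∈ B k, b k i = (a k).val i := by
    intro k i hi
    cases k with
    | zero => rfl
    | succ k => rw [hbs, if_pos hi]
  have hstep : ∀ k i, dist (b k i) (b (k + 1) i) ≤ 2 / 2 / 2 ^ k := by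
    intro k i
    by_cases h : i ∈ B (k + 1)
    · have h1 : i ∈ B k := fun j hj => h j (Nat.lt_succ_of_lt hj)
      rw [hba _ _ h, hba _ _ h1]
      have h2 : dist ((a k).val i) ((a (k + 1)).val i) < (1 / 2 : ℝ) ^ k := h k (Nat.lt_succ_self k)
      refine h2.le.trans (le_of_eq ?_)
      rw [one_div, inv_pow]; simp
    · rw [hbs, if_neg h, dist_self]; positivity
  have hlim : ∀ i, ∃ x, Tendsto (fun k => b k i) atTop (𝓝 x) := fun i =>
    cauchySeq_tendsto_of_complete (cauchySeq_of_le_geometric_two (hstep · i))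
  choose x hx using hlim
  refine ⟨⟨x⟩, ?_⟩
  have hle : ∀ k, dist (a k) ⟨x⟩ ≤ 2 / 2 ^ k := by
    intro k
    refine le_of_tendsto (PreUltra.tendsto_dist M U S (a k) ⟨x⟩) ?_
    filter_upwards [hB k] with i hi
    rw [← hba k i hi]
    exact dist_le_of_le_geometric_two_of_tendsto (hstep · i) (hx i) k
  rw [tendsto_iff_dist_tendsto_zero]
  refine squeeze_zero (fun _ => dist_nonneg) hle ?_
  have := (tendsto_pow_atTop_nhds_zero_of_lt_one (r := (1 / 2 : ℝ)) (by norm_num)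
    (by norm_num)).const_mul 2
  simpa [div_eq_mul_inv] using this

/-- The sorts of the ultraproduct: the metric quotients. -/
abbrev UltraSort (S : L.Sorts) : Type (max v w) := SeparationQuotient (PreUltra M U S)

/-- The class `[(a_i)_i]`. -/
def ultraMk {S : L.Sorts} (a : ∀ i, (M i).carrier S) : UltraSort M U S :=
  SeparationQuotient.mk ⟨a⟩

/-- A chosen representative of an element of the ultraproduct. -/
def ultraRep {S : L.Sorts} (x : UltraSort M U S) : ∀ i, (M i).carrier S :=
  (Function.surjInv SeparationQuotient.surjective_mk x).val

variable {M U} in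
theorem ultraMk_rep {S : L.Sorts} (x : UltraSort M U S) : ultraMk M U (ultraRep M U x) = x :=
  Function.surjInv_eq SeparationQuotient.surjective_mk x

theorem dist_ultraMk {S : L.Sorts} (a b : ∀ i, (M i).carrier S) :
    dist (ultraMk M U a) (ultraMk M U b) = ulim U fun i => dist (a i) (b i) := rfl

theorem tendsto_dist_rep {S : L.Sorts} (x y : UltraSort M U S) :
    Tendsto (fun i => dist (ultraRep M U x i) (ultraRep M U y i)) U (𝓝 (dist x y)) := by
  conv => rhs; rw [← ultraMk_rep x, ← ultraMk_rep y]
  exact tendsto_dist M U S _ _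

/-- The ultraproduct of a family of metric structures. -/
def ultraproduct : Struc.{u, max v w} L where
  carrier S := UltraSort M U S
  metric S := inferInstance
  complete S := inferInstance
  nonempty S := ⟨ultraMk M U fun _ => Classical.arbitrary _⟩
  dist_le S x y := le_of_tendsto' (tendsto_dist_rep M U x y) fun i => (M i).dist_le S _ _
  funMap f x := ultraMk M U fun i => (M i).funMap f fun k => ultraRep M U (x k) i
  funMap_unif f ε x y h := by
    refine le_of_tendsto (tendsto_dist M U _ _ _) ?_
    have : ∀ᶠ i in (U : Filter I), ∀ k,
        dist (ultraRep M U (x k) i) (ultraRep M U (y k) i) < (L.funMod f ε : ℝ) :=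
      eventually_all.2 fun k => (tendsto_dist_rep M U (x k) (y k)).eventually_lt_const (h k)
    filter_upwards [this] with i hi
    exact (M i).funMap_unif f ε _ _ hi
  relMap R x := ulim U fun i => (M i).relMap R fun k => ultraRep M U (x k) i
  relMap_mem R x :=
    isClosed_Icc.mem_of_tendsto (tendsto_ulim U fun i => (M i).relMap_mem R _)
      (Eventually.of_forall fun i => (M i).relMap_mem R _)
  relMap_unif R ε x y h := by
    refine le_of_tendsto ((tendsto_ulim U fun i => (M i).relMap_mem R _).sub
      (tendsto_ulim U fun i => (M i).relMap_mem R _)).abs ?_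
    have : ∀ᶠ i in (U : Filter I), ∀ k,
        dist (ultraRep M U (x k) i) (ultraRep M U (y k) i) < (L.relMod R ε : ℝ) :=
      eventually_all.2 fun k => (tendsto_dist_rep M U (x k) (y k)).eventually_lt_const (h k)
    filter_upwards [this] with i hi
    exact (M i).relMap_unif R ε _ _ hi

theorem eventually_rep_mk {n : ℕ} {σ : Fin n → L.Sorts} (a : ∀ k, ∀ i, (M i).carrier (σ k))
    {δ : ℝ} (hδ : 0 < δ) :
    ∀ᶠ i in (U : Filter I), ∀ k, dist (ultraRep M U (ultraMk M U (a k)) i) (a k i) < δ := by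
  refine eventually_all.2 fun k => ?_
  have h : dist (ultraMk M U (ultraRep M U (ultraMk M U (a k)))) (ultraMk M U (a k)) = 0 := by
    rw [ultraMk_rep, dist_self]
  rw [dist_ultraMk] at h
  have := tendsto_dist M U _ (ultraRep M U (ultraMk M U (a k))) (a k)
  rw [h] at this
  exact this.eventually_lt_const hδ

/-- Functions are computed coordinatewise, for any choice of representatives. -/
theorem ultraproduct_funMap_mk (f : L.Functions) (a : ∀ k, ∀ i, (M i).carrier (L.funDom f k)) :
    (ultraproduct M U).funMap f (fun k => ultraMk M U (a k)) =
      ultraMk M U fun i => (M i).funMap f fun k => a k i := by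
  refine eq_of_forall_dist_le fun ε hε => ?_
  have hε' : min ε 1 ∈ Set.Ioc (0 : ℝ) 1 := ⟨lt_min hε one_pos, min_le_right _ _⟩
  refine le_of_tendsto (tendsto_dist M U _ _ _) ?_
  filter_upwards [eventually_rep_mk M U a (L.funMod f ⟨_, hε'⟩).2.1] with i hi
  exact ((M i).funMap_unif f ⟨_, hε'⟩ _ _ hi).trans (min_le_left _ _)

/-- Relations are `U`-limits of the coordinatewise values, for any choice of representatives. -/
theorem ultraproduct_relMap_mk (R : L.Relations) (a : ∀ k, ∀ i, (M i).carrier (L.relDom R k)) :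
    (ultraproduct M U).relMap R (fun k => ultraMk M U (a k)) =
      ulim U fun i => (M i).relMap R fun k => a k i := by
  refine eq_of_forall_dist_le fun ε hε => ?_
  have hε' : min ε 1 ∈ Set.Ioc (0 : ℝ) 1 := ⟨lt_min hε one_pos, min_le_right _ _⟩
  refine le_of_tendsto ((tendsto_ulim U fun i => (M i).relMap_mem R _).dist
    (tendsto_ulim U fun i => (M i).relMap_mem R _)) ?_
  filter_upwards [eventually_rep_mk M U a (L.relMod R ⟨_, hε'⟩).2.1] with i hi
  exact ((M i).relMap_unif R ⟨_, hε'⟩ _ _ hi).trans (min_le_left _ _)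

/-- The ultrapower `M^U`. -/
def Struc.ultrapower (N : Struc.{u, w} L) (U : Ultrafilter I) : Struc.{u, max v w} L :=
  ultraproduct (fun _ => N) U

end Ultraproduct

/-- An ultrafilter that is not principal. -/
def Nonprincipal {I : Type v} (U : Ultrafilter I) : Prop := ∀ i, U ≠ pure i

end MetricLanguage

end

/-!
The relation `φ = 0` on a definable set `X` is asymmetric, and every finite subset of `X(M)` has an
upper bound in `X(M)`. Models are told apart by the cofinality of this relation, which, when it is
an uncountable regular cardinal, is not changed by ultrapowers over `ω`.

Call a family `(c i)` in `X(M)`, indexed by a linear order `ι`, a *scale* (`IsScale`) if every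
`x ∈ X(M)` satisfies `φ(x, c j) = 0` for all sufficiently large `j`. If countable subsets of `ι` are
strictly bounded, the constant sequences over a scale form a scale of every ultrapower over `ω`:
a point of `X` in the ultrapower is represented by a sequence in `X(M)`, whose countably many
thresholds have a common bound (`IsScale.ultrapower`). If `N` has a scale indexed by `ι`, and `M` one
indexed by `κ`, and every map `ι → κ` has strictly bounded range, then an isomorphism from `N` to `M`
would send the scale of `N` to a family which is bounded by some `d j`. The preimage of `d j` bounds
the scale of `N` and lies below one of its members, against asymmetry (`IsScale.not_isomorphic`). As
the Continuum Hypothesis fails, this applies to `ω₁` and `ω₂`, both of size at most `𝔠`.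

It remains to find, for `ι` equal to `ω₁` or `ω₂`, a model of density character at most `𝔠` with a
scale indexed by `ι` (`exists_model_isScale`). Everything happens inside one model `M` in which all
families of size at most `𝔠` in `X(M)` are bounded. Such a model is an ultrapower over the finite
subsets of `ℝ`, with respect to an ultrafilter containing the cones (`exists_model_bounding`). By
recursion, `c i` is chosen as a bound of the part of `X(M)` in the closed Skolem hull of the `c j`
with `j < i`. Since the language is separable relative to the theory, countably many approximate
Skolem functions suffice, so that these closed hulls have at most `𝔠` points in each sort and, by
the Tarski–Vaught test (`Embedding.TarskiVaught.eval_eq`, `hasWitnesses_closedHull`), the closed hull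
of all `c i` is an elementary substructure. It is the union of the closed hulls of the initial
segments because countable subsets of `ι` are bounded, so the `c i` form a scale of it.

Both kinds of ultrapowers rest on the theorem of Łoś (`tendsto_eval_ultraproduct`).
-/

noncomputable section

namespace MetricLanguage

variable {L : MetricLanguage.{u}}

/-! ### Bounds and moduli of continuity of formulas -/

theorem exists_pos_forall_le {ι : Type*} [Finite ι] (f : ι → ℝ) (hf : ∀ i, 0 < f i) :
    ∃ δ > 0, ∀ i, δ ≤ f i := by
  cases isEmpty_or_nonempty ι with
  | inl h => exact ⟨1, one_pos, fun i => h.elim i⟩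
  | inr h =>
    obtain ⟨i, hi⟩ := Finite.exists_min f
    exact ⟨f i, hf i, hi⟩

theorem ciInf_eq_neg_ciSup_neg {ι : Type*} (f : ι → ℝ) : ⨅ i, f i = -⨆ i, -f i := by
  rw [iInf, Real.sInf_def, iSup]
  congr 2
  ext x
  simp [neg_eq_iff_eq_neg]

theorem abs_ciSup_sub_ciSup_le {ι : Type*} [Nonempty ι] {f g : ι → ℝ} {C ε : ℝ}
    (hf : ∀ i, |f i| ≤ C) (hg : ∀ i, |g i| ≤ C) (h : ∀ i, |f i - g i| ≤ ε) :
    |(⨆ i, f i) - ⨆ i, g i| ≤ ε := by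
  have bf : BddAbove (Set.range f) := ⟨C, by rintro _ ⟨i, rfl⟩; exact (abs_le.1 (hf i)).2⟩
  have bg : BddAbove (Set.range g) := ⟨C, by rintro _ ⟨i, rfl⟩; exact (abs_le.1 (hg i)).2⟩
  rw [abs_sub_le_iff]
  constructor
  · rw [sub_le_iff_le_add]
    exact ciSup_le fun i => by linarith [(abs_le.1 (h i)).2, le_ciSup bg i]
  · rw [sub_le_iff_le_add]
    exact ciSup_le fun i => by linarith [(abs_le.1 (h i)).1, le_ciSup bf i]

theorem abs_ciSup_le {ι : Type*} [Nonempty ι] {f : ι → ℝ} {C : ℝ} (hf : ∀ i, |f i| ≤ C) :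
    |⨆ i, f i| ≤ C := by
  have hC : 0 ≤ C := (abs_nonneg _).trans (hf (Classical.arbitrary ι))
  have := abs_ciSup_sub_ciSup_le (f := f) (g := fun _ => (0 : ℝ)) hf (by simpa using hC)
    (by simpa using hf)
  simpa using this

/-- Terms are uniformly continuous, with a modulus which does not depend on the structure. -/
theorem Term.exists_modulus {β : Type} {τ : β → L.Sorts} {S : L.Sorts} (t : Term L τ S) {ε : ℝ}
    (hε : 0 < ε) : ∃ δ > 0, ∀ (M : Struc.{u, w} L) (v v' : ∀ i, M.carrier (τ i)),
      (∀ i, dist (v i) (v' i) < δ) → dist (t.eval M v) (t.eval M v') ≤ ε := by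
  induction t generalizing ε with
  | var i => exact ⟨ε, hε, fun M v v' h => (h i).le⟩
  | func f ts ih =>
    let ε' : Set.Ioc (0 : ℝ) 1 := ⟨min ε 1, lt_min hε one_pos, min_le_right _ _⟩
    have hm := (L.funMod f ε').2.1
    choose δ hδ h using fun i => ih i (half_pos hm)
    obtain ⟨δ₀, h₀, h₁⟩ := exists_pos_forall_le δ hδ
    exact ⟨δ₀, h₀, fun M v v' hv => (M.funMap_unif f ε' _ _ fun i =>
      (h i M v v' fun k => (hv k).trans_le (h₁ i)).trans_lt (half_lt_self hm)).trans
        (min_le_left _ _)⟩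

/-- Formulas are bounded, with a bound which does not depend on the structure. -/
theorem BFormula.exists_bound {α : Type} {σ : α → L.Sorts} {l : List L.Sorts}
    (φ : BFormula L σ l) :
    ∃ C : ℝ, ∀ (M : Struc.{u, w} L) (v : ∀ i, M.carrier (σ i)) (x : ∀ i, M.carrier (l.get i)),
      |φ.eval M v x| ≤ C := by
  induction φ with
  | dist S s t =>
    exact ⟨L.bound S, fun M v x => by
      rw [BFormula.eval, abs_of_nonneg dist_nonneg]; exact M.dist_le S _ _⟩
  | rel R ts =>
    refine ⟨max |L.relLo R| |L.relHi R|, fun M v x => ?_⟩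
    have h := M.relMap_mem R fun i => (ts i).eval M (joinEnv M v x)
    exact abs_le_max_abs_abs h.1 h.2
  | conn n g φ ih =>
    choose C hC using ih
    obtain ⟨D, hD⟩ := (isCompact_univ_pi fun i => isCompact_Icc (a := -C i) (b := C i))
      |>.exists_bound_of_continuousOn g.continuous.continuousOn
    exact ⟨D, fun M v x => hD _ fun i _ => abs_le.1 (hC i M v x)⟩
  | sup S φ ih =>
    obtain ⟨C, hC⟩ := ih
    exact ⟨C, fun M v x => abs_ciSup_le fun b => hC M v _⟩
  | inf S φ ih =>
    obtain ⟨C, hC⟩ := ih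
    refine ⟨C, fun M v x => ?_⟩
    rw [BFormula.eval, ciInf_eq_neg_ciSup_neg, abs_neg]
    exact abs_ciSup_le fun b => by rw [abs_neg]; exact hC M v _

theorem dist_joinEnv_lt {M : Struc.{u, w} L} {α : Type} {σ : α → L.Sorts} {l : List L.Sorts}
    {v v' : ∀ i, M.carrier (σ i)} {x x' : ∀ i, M.carrier (l.get i)} {δ : ℝ}
    (hv : ∀ i, dist (v i) (v' i) < δ) (hx : ∀ i, dist (x i) (x' i) < δ) :
    ∀ i, dist (joinEnv M v x i) (joinEnv M v' x' i) < δ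
  | .inl i => hv i
  | .inr i => hx i

theorem dist_consEnv_lt {M : Struc.{u, w} L} {S : L.Sorts} {l : List L.Sorts} {b b' : M.carrier S}
    {x x' : ∀ i, M.carrier (l.get i)} {δ : ℝ} (hb : dist b b' < δ)
    (hx : ∀ i, dist (x i) (x' i) < δ) :
    ∀ i, dist (consEnv M b x i) (consEnv M b' x' i) < δ
  | ⟨0, _⟩ => hb
  | ⟨i + 1, h⟩ => hx ⟨i, Nat.lt_of_succ_lt_succ h⟩

/-- Formulas are uniformly continuous, with a modulus which does not depend on the structure. -/
theorem BFormula.exists_modulus {α : Type} {σ : α → L.Sorts} {l : List L.Sorts}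
    (φ : BFormula L σ l) {ε : ℝ} (hε : 0 < ε) :
    ∃ δ > 0, ∀ (M : Struc.{u, w} L) (v v' : ∀ i, M.carrier (σ i))
      (x x' : ∀ i, M.carrier (l.get i)), (∀ i, Dist.dist (v i) (v' i) < δ) →
      (∀ i, Dist.dist (x i) (x' i) < δ) → |φ.eval M v x - φ.eval M v' x'| ≤ ε := by
  induction φ generalizing ε with
  | dist S s t =>
    obtain ⟨δ₁, h₁, h₁'⟩ := Term.exists_modulus.{u, w} s (half_pos hε)
    obtain ⟨δ₂, h₂, h₂'⟩ := Term.exists_modulus.{u, w} t (half_pos hε)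
    refine ⟨min δ₁ δ₂, lt_min h₁ h₂, fun M v v' x x' hv hx => ?_⟩
    have h := dist_joinEnv_lt hv hx
    have a := h₁' M _ _ fun i => (h i).trans_le (min_le_left _ _)
    have b := h₂' M _ _ fun i => (h i).trans_le (min_le_right _ _)
    have := dist_dist_dist_le (s.eval M (joinEnv M v x)) (t.eval M (joinEnv M v x))
      (s.eval M (joinEnv M v' x')) (t.eval M (joinEnv M v' x'))
    rw [Real.dist_eq] at this
    rw [BFormula.eval, BFormula.eval]
    linarith
  | rel R ts =>
    let ε' : Set.Ioc (0 : ℝ) 1 := ⟨min ε 1, lt_min hε one_pos, min_le_right _ _⟩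
    have hm := (L.relMod R ε').2.1
    choose δ hδ h using fun i => Term.exists_modulus.{u, w} (ts i) (half_pos hm)
    obtain ⟨δ₀, h₀, h₁⟩ := exists_pos_forall_le δ hδ
    exact ⟨δ₀, h₀, fun M v v' x x' hv hx => (M.relMap_unif R ε' _ _ fun i =>
      (h i M _ _ fun k => (dist_joinEnv_lt hv hx k).trans_le (h₁ i)).trans_lt
        (half_lt_self hm)).trans (min_le_left _ _)⟩
  | conn n g φ ih =>
    choose C hC using fun i => BFormula.exists_bound.{u, w} (φ i)
    have hK := isCompact_univ_pi fun i => isCompact_Icc (a := -C i) (b := C i)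
    obtain ⟨η, hη, hg⟩ := Metric.uniformContinuousOn_iff_le.1
      (hK.uniformContinuousOn_of_continuous g.continuous.continuousOn) ε hε
    choose δ hδ h using fun i => ih i hη
    obtain ⟨δ₀, h₀, h₁⟩ := exists_pos_forall_le δ hδ
    refine ⟨δ₀, h₀, fun M v v' x x' hv hx => hg _ (fun i _ => abs_le.1 (hC i M v x)) _
      (fun i _ => abs_le.1 (hC i M v' x')) ((dist_pi_le_iff hη.le).2 fun i => ?_)⟩
    exact h i M v v' x x' (fun k => (hv k).trans_le (h₁ i)) fun k => (hx k).trans_le (h₁ i)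
  | sup S φ ih =>
    obtain ⟨C, hC⟩ := BFormula.exists_bound.{u, w} φ
    obtain ⟨δ, hδ, h⟩ := ih hε
    exact ⟨δ, hδ, fun M v v' x x' hv hx => abs_ciSup_sub_ciSup_le (fun b => hC M v _)
      (fun b => hC M v' _) fun b => h M v v' _ _ hv (dist_consEnv_lt (by simpa using hδ) hx)⟩
  | inf S φ ih =>
    obtain ⟨C, hC⟩ := BFormula.exists_bound.{u, w} φ
    obtain ⟨δ, hδ, h⟩ := ih hε
    refine ⟨δ, hδ, fun M v v' x x' hv hx => ?_⟩
    rw [BFormula.eval, BFormula.eval, ciInf_eq_neg_ciSup_neg, ciInf_eq_neg_ciSup_neg,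
      neg_sub_neg, abs_sub_comm]
    refine abs_ciSup_sub_ciSup_le (C := C) (fun b => ?_) (fun b => ?_) fun b => ?_
    · rw [abs_neg]; exact hC M v _
    · rw [abs_neg]; exact hC M v' _
    · rw [neg_sub_neg, abs_sub_comm]
      exact h M v v' _ _ hv (dist_consEnv_lt (by simpa using hδ) hx)

/-- The formula `-φ`. -/
def BFormula.neg {α : Type} {σ : α → L.Sorts} {l : List L.Sorts} (φ : BFormula L σ l) :
    BFormula L σ l :=
  .conn 1 ⟨fun r => -r 0, by fun_prop⟩ fun _ => φ

theorem BFormula.eval_neg {α : Type} {σ : α → L.Sorts} {l : List L.Sorts} (φ : BFormula L σ l)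
    (M : Struc.{u, w} L) (v : ∀ i, M.carrier (σ i)) (x : ∀ i, M.carrier (l.get i)) :
    φ.neg.eval M v x = -φ.eval M v x := rfl

/-! ### The Tarski–Vaught test -/

theorem Embedding.eval_term {N M : Struc.{u, w} L} (ρ : Embedding N M) {β : Type}
    {τ : β → L.Sorts} {S : L.Sorts} (t : Term L τ S) (v : ∀ i, N.carrier (τ i)) :
    ρ.toFun S (t.eval N v) = t.eval M fun i => ρ.toFun _ (v i) := by
  induction t with
  | var i => rfl
  | func f ts ih =>
    simp only [Term.eval, ρ.map_fun, ih]

theorem Embedding.joinEnv_comp {N M : Struc.{u, w} L} (ρ : Embedding N M) {α : Type}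
    {σ : α → L.Sorts} {l : List L.Sorts} (v : ∀ i, N.carrier (σ i))
    (x : ∀ i, N.carrier (l.get i)) :
    (fun i => ρ.toFun _ (joinEnv N v x i)) =
      joinEnv M (fun i => ρ.toFun _ (v i)) fun i => ρ.toFun _ (x i) := by
  funext i
  cases i <;> rfl

theorem Embedding.consEnv_comp {N M : Struc.{u, w} L} (ρ : Embedding N M) {S : L.Sorts}
    {l : List L.Sorts} (b : N.carrier S) (x : ∀ i, N.carrier (l.get i)) :
    (fun i => ρ.toFun _ (consEnv N b x i)) = consEnv M (ρ.toFun _ b) fun i => ρ.toFun _ (x i) := by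
  funext ⟨i, hi⟩
  cases i <;> rfl

/-- The condition of the Tarski–Vaught test, for formulas with free variables of sorts `σ`: the
values of a formula with parameters in the image of `ρ` are approximated from above by values at
points of this image. -/
def Embedding.TarskiVaught {N M : Struc.{u, w} L} (ρ : Embedding N M) {α : Type}
    (σ : α → L.Sorts) : Prop :=
  ∀ (l : List L.Sorts) (S : L.Sorts) (φ : BFormula L σ (S :: l)) (v : ∀ i, N.carrier (σ i))
    (x : ∀ i, N.carrier (l.get i)) (b : M.carrier S) (ε : ℝ), 0 < ε → ∃ b' : N.carrier S,
      φ.eval M (fun i => ρ.toFun _ (v i)) (consEnv M (ρ.toFun _ b') fun i => ρ.toFun _ (x i)) ≤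
        φ.eval M (fun i => ρ.toFun _ (v i)) (consEnv M b fun i => ρ.toFun _ (x i)) + ε

theorem ciSup_comp_eq {ι κ : Type*} [Nonempty ι] [Nonempty κ] {f : ι → ℝ} {C : ℝ}
    (hf : ∀ i, |f i| ≤ C) (e : κ → ι) (h : ∀ i, ∀ ε > 0, ∃ k, f i ≤ f (e k) + ε) :
    ⨆ k, f (e k) = ⨆ i, f i := by
  have bf : BddAbove (Set.range f) := ⟨C, by rintro _ ⟨i, rfl⟩; exact (abs_le.1 (hf i)).2⟩
  have be : BddAbove (Set.range fun k => f (e k)) :=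
    ⟨C, by rintro _ ⟨i, rfl⟩; exact (abs_le.1 (hf _)).2⟩
  refine le_antisymm (ciSup_le fun k => le_ciSup bf (e k)) (ciSup_le fun i => ?_)
  refine le_of_forall_pos_le_add fun ε hε => ?_
  obtain ⟨k, hk⟩ := h i ε hε
  exact hk.trans (by linarith [le_ciSup be k])

/-- The Tarski–Vaught test: embeddings which satisfy the condition preserve the values of formulas. -/
theorem Embedding.TarskiVaught.eval_eq {N M : Struc.{u, w} L} {ρ : Embedding N M} {α : Type}
    {σ : α → L.Sorts} (hρ : ρ.TarskiVaught σ) {l : List L.Sorts} (φ : BFormula L σ l)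
    (v : ∀ i, N.carrier (σ i)) (x : ∀ i, N.carrier (l.get i)) :
    φ.eval N v x = φ.eval M (fun i => ρ.toFun _ (v i)) fun i => ρ.toFun _ (x i) := by
  induction φ with
  | dist S s t =>
    simp only [BFormula.eval]
    rw [← ρ.map_dist, ρ.eval_term, ρ.eval_term, ρ.joinEnv_comp]
  | rel R ts =>
    simp only [BFormula.eval, ρ.map_rel, ρ.eval_term, ρ.joinEnv_comp]
  | conn n g φ ih =>
    simp only [BFormula.eval, ih]
  | sup S φ ih =>
    obtain ⟨C, hC⟩ := BFormula.exists_bound.{u, w} φ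
    simp only [BFormula.eval, ih, ρ.consEnv_comp]
    refine ciSup_comp_eq (f := fun b => φ.eval M _ (consEnv M b _)) (fun b => hC M _ _) _
      fun b ε hε => ?_
    -- Approximation from below for `φ` is approximation from above for `-φ`.
    obtain ⟨b', hb'⟩ := hρ _ _ φ.neg v x b ε hε
    rw [BFormula.eval_neg, BFormula.eval_neg] at hb'
    exact ⟨b', by linarith⟩
  | inf S φ ih =>
    obtain ⟨C, hC⟩ := BFormula.exists_bound.{u, w} φ
    simp only [BFormula.eval, ih, ρ.consEnv_comp]
    rw [ciInf_eq_neg_ciSup_neg, ciInf_eq_neg_ciSup_neg]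
    congr 1
    refine ciSup_comp_eq (f := fun b => -φ.eval M _ (consEnv M b _)) (C := C)
      (fun b => by rw [abs_neg]; exact hC M _ _) _ fun b ε hε => ?_
    obtain ⟨b', hb'⟩ := hρ _ _ φ v x b ε hε
    exact ⟨b', by linarith⟩

theorem Embedding.IsIsomorphism.tarskiVaught {N M : Struc.{u, w} L} {ρ : Embedding N M}
    (hρ : ρ.IsIsomorphism) {α : Type} (σ : α → L.Sorts) : ρ.TarskiVaught σ := by
  intro l S φ v x b ε hε
  obtain ⟨b', rfl⟩ := hρ S b
  exact ⟨b', by linarith⟩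

theorem Embedding.TarskiVaught.formula_eval_eq {N M : Struc.{u, w} L} {ρ : Embedding N M}
    {α : Type} {σ : α → L.Sorts} (hρ : ρ.TarskiVaught σ) (φ : L.Formula σ)
    (v : ∀ i, N.carrier (σ i)) :
    φ.eval N v = φ.eval M fun i => ρ.toFun _ (v i) := by
  rw [Formula.eval, Formula.eval, hρ.eval_eq]
  congr 1
  funext i
  exact i.elim0

/-! ### The theorem of Łoś -/

section Los

variable {I : Type v} (M : I → Struc.{u, w} L) (U : Ultrafilter I)

theorem eval_term_ultraproduct {β : Type} {τ : β → L.Sorts} {S : L.Sorts} (t : Term L τ S)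
    (v : ∀ k, ∀ i, (M i).carrier (τ k)) :
    t.eval (ultraproduct M U) (fun k => ultraMk M U (v k)) =
      ultraMk M U fun i => t.eval (M i) fun k => v k i := by
  induction t with
  | var i => rfl
  | func f ts ih =>
    simp only [Term.eval]
    rw [← ultraproduct_funMap_mk]
    congr 1
    funext k
    exact ih k

theorem joinEnv_ultraMk {α : Type} {σ : α → L.Sorts} {l : List L.Sorts}
    (v : ∀ k, ∀ i, (M i).carrier (σ k)) (x : ∀ k, ∀ i, (M i).carrier (l.get k)) :
    joinEnv (ultraproduct M U) (fun k => ultraMk M U (v k)) (fun k => ultraMk M U (x k)) =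
      fun k => ultraMk M U fun i => joinEnv (M i) (fun k => v k i) (fun k => x k i) k := by
  funext k
  cases k <;> rfl

theorem consEnv_ultraMk {S : L.Sorts} {l : List L.Sorts} (b : ∀ i, (M i).carrier S)
    (x : ∀ k, ∀ i, (M i).carrier (l.get k)) :
    consEnv (ultraproduct M U) (ultraMk M U b) (fun k => ultraMk M U (x k)) =
      fun k => ultraMk M U fun i => consEnv (M i) (b i) (fun k => x k i) k := by
  funext ⟨k, hk⟩
  cases k <;> rfl

/-- Suprema commute with ultraproducts of uniformly bounded families of functions. -/
theorem tendsto_ciSup_ultraproduct {S : L.Sorts} {C : ℝ} (f : ∀ i, (M i).carrier S → ℝ)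
    (hf : ∀ i b, |f i b| ≤ C) (F : UltraSort M U S → ℝ)
    (h : ∀ b : ∀ i, (M i).carrier S, Tendsto (fun i => f i (b i)) U (𝓝 (F (ultraMk M U b)))) :
    Tendsto (fun i => ⨆ b, f i b) U (𝓝 (⨆ b, F b)) := by
  have bf : ∀ i, BddAbove (Set.range (f i)) := fun i =>
    ⟨C, by rintro _ ⟨b, rfl⟩; exact (abs_le.1 (hf i b)).2⟩
  have hr := tendsto_ulim U (x := fun i => ⨆ b, f i b) (a := -C) (b := C) fun i =>
    abs_le.1 (abs_ciSup_le (hf i))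
  have hF : ∀ b, F b ≤ ulim U fun i => ⨆ b, f i b := fun b => by
    rw [← ultraMk_rep b]
    exact le_of_tendsto_of_tendsto' (h _) hr fun i => le_ciSup (bf i) _
  have : Nonempty (UltraSort M U S) := (ultraproduct M U).nonempty S
  convert hr using 2
  refine le_antisymm (ciSup_le hF) (le_of_forall_pos_le_add fun ε hε => ?_)
  choose b hb using fun i => exists_lt_of_lt_ciSup (sub_lt_self (⨆ b, f i b) hε)
  have h₁ := le_of_tendsto_of_tendsto' hr ((h b).add_const ε) fun i => by linarith [hb i]
  exact h₁.trans (by linarith [le_ciSup (⟨_, by rintro _ ⟨b, rfl⟩; exact hF b⟩ :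
    BddAbove (Set.range F)) (ultraMk M U b)])

/-- The theorem of Łoś: the value of a formula in an ultraproduct is the limit of its values in the
factors. -/
theorem tendsto_eval_ultraproduct {α : Type} {σ : α → L.Sorts} {l : List L.Sorts}
    (φ : BFormula L σ l) (v : ∀ k, ∀ i, (M i).carrier (σ k))
    (x : ∀ k, ∀ i, (M i).carrier (l.get k)) :
    Tendsto (fun i => φ.eval (M i) (fun k => v k i) fun k => x k i) U
      (𝓝 (φ.eval (ultraproduct M U) (fun k => ultraMk M U (v k)) fun k => ultraMk M U (x k))) := by
  induction φ with
  | dist S s t =>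
    simp only [BFormula.eval, joinEnv_ultraMk, eval_term_ultraproduct]
    exact tendsto_dist M U S _ _
  | rel R ts =>
    simp only [BFormula.eval, joinEnv_ultraMk, eval_term_ultraproduct, ultraproduct_relMap_mk]
    exact tendsto_ulim U fun i => (M i).relMap_mem R _
  | conn n g φ ih =>
    simp only [BFormula.eval]
    exact (g.continuous.tendsto _).comp (tendsto_pi_nhds.2 fun k => ih k x)
  | sup S φ ih =>
    obtain ⟨C, hC⟩ := BFormula.exists_bound.{u, w} φ
    simp only [BFormula.eval]
    refine tendsto_ciSup_ultraproduct M U (C := C) _ (fun i b => hC _ _ _)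
      (fun b => φ.eval (ultraproduct M U) _ (consEnv (ultraproduct M U) b _)) fun b => ?_
    simp only [consEnv_ultraMk]
    exact ih fun k i => consEnv (M i) (b i) (fun k => x k i) k
  | inf S φ ih =>
    obtain ⟨C, hC⟩ := BFormula.exists_bound.{u, w} φ
    simp only [BFormula.eval, ciInf_eq_neg_ciSup_neg]
    refine (tendsto_ciSup_ultraproduct M U (C := C) _ (fun i b => ?_)
      (fun b => -φ.eval (ultraproduct M U) _ (consEnv (ultraproduct M U) b _)) fun b => ?_).neg
    · rw [abs_neg]; exact hC _ _ _
    · simp only [consEnv_ultraMk]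
      exact (ih fun k i => consEnv (M i) (b i) (fun k => x k i) k).neg

theorem Formula.eval_eq {α : Type} {σ : α → L.Sorts} (φ : L.Formula σ) (N : Struc.{u, w} L)
    (v : ∀ k, N.carrier (σ k)) (x : ∀ k, N.carrier (([] : List L.Sorts).get k)) :
    φ.eval N v = BFormula.eval N v φ x := by
  rw [Formula.eval]
  congr 1
  funext k
  exact k.elim0

theorem tendsto_formula_eval_ultraproduct {α : Type} {σ : α → L.Sorts} (φ : L.Formula σ)
    (v : ∀ k, ∀ i, (M i).carrier (σ k)) :
    Tendsto (fun i => φ.eval (M i) fun k => v k i) U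
      (𝓝 (φ.eval (ultraproduct M U) fun k => ultraMk M U (v k))) := by
  have e := Formula.eval_eq φ (ultraproduct M U) (fun k => ultraMk M U (v k))
    fun k => ultraMk M U (k.elim0)
  exact ((tendsto_eval_ultraproduct M U φ v fun k => k.elim0).mono_right
    (congrArg 𝓝 e).ge).congr fun i => (Formula.eval_eq φ (M i) _ _).symm

theorem models_ultraproduct {T : Set L.Sentence} (h : ∀ i, Models (M i) T) :
    Models (ultraproduct M U) T := by
  intro φ hφ
  have h₁ := tendsto_formula_eval_ultraproduct M U φ fun k => k.elim
  have h₂ : ∀ i, Formula.eval φ (M i) (fun k => k.elim) = 0 := fun i => h i φ hφ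
  have h₃ := tendsto_nhds_unique (h₁.congr fun i => (congrArg _ (funext fun k => k.elim)).trans
    (h₂ i)) tendsto_const_nhds
  exact (congrArg _ (funext fun k => k.elim)).trans h₃

end Los

/-! ### Renaming of variables -/

theorem Term.exists_rename {β γ : Type} {τ : β → L.Sorts} {τ' : γ → L.Sorts} (g : β → γ)
    (hg : ∀ i, τ' (g i) = τ i) {S : L.Sorts} (t : Term L τ S) :
    ∃ t' : Term L τ' S, ∀ (M : Struc.{u, w} L) (v : ∀ i, M.carrier (τ i))
      (v' : ∀ j, M.carrier (τ' j)), (∀ i, HEq (v' (g i)) (v i)) → t'.eval M v' = t.eval M v := by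
  induction t with
  | var i =>
    have key : ∀ S, τ' (g i) = S → ∃ t' : Term L τ' S, ∀ (M : Struc.{u, w} L)
        (v' : ∀ j, M.carrier (τ' j)), HEq (t'.eval M v') (v' (g i)) := by
      rintro S rfl
      exact ⟨.var (g i), fun M v' => HEq.rfl⟩
    obtain ⟨t', ht'⟩ := key _ (hg i)
    exact ⟨t', fun M v v' h => eq_of_heq ((ht' M v').trans (h i))⟩
  | func f ts ih =>
    choose ts' h' using ih
    refine ⟨.func f ts', fun M v v' h => ?_⟩
    simp only [Term.eval]
    congr 1
    funext i
    exact h' i M v v' h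

/-- A renaming of the free and bound variables, extended by one bound variable. -/
def extendRenaming {α α' : Type} {l l' : List L.Sorts} (S : L.Sorts)
    (g : α ⊕ Fin l.length → α' ⊕ Fin l'.length) :
    α ⊕ Fin (S :: l).length → α' ⊕ Fin (S :: l').length
  | .inl i => Sum.map id Fin.succ (g (.inl i))
  | .inr ⟨0, _⟩ => .inr ⟨0, Nat.succ_pos _⟩
  | .inr ⟨i + 1, h⟩ => Sum.map id Fin.succ (g (.inr ⟨i, Nat.lt_of_succ_lt_succ h⟩))

theorem sum_elim_map_succ {α' : Type} {σ' : α' → L.Sorts} {l' : List L.Sorts} (S : L.Sorts)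
    (z : α' ⊕ Fin l'.length) :
    Sum.elim σ' (S :: l').get (Sum.map id Fin.succ z) = Sum.elim σ' l'.get z := by
  cases z <;> rfl

theorem sum_elim_extendRenaming {α α' : Type} {σ : α → L.Sorts} {σ' : α' → L.Sorts}
    {l l' : List L.Sorts} (S : L.Sorts) {g : α ⊕ Fin l.length → α' ⊕ Fin l'.length}
    (hg : ∀ i, Sum.elim σ' l'.get (g i) = Sum.elim σ l.get i) :
    ∀ i, Sum.elim σ' (S :: l').get (extendRenaming S g i) = Sum.elim σ (S :: l).get i
  | .inl i => (sum_elim_map_succ S _).trans (hg (.inl i))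
  | .inr ⟨0, _⟩ => rfl
  | .inr ⟨i + 1, h⟩ =>
    (sum_elim_map_succ S _).trans (hg (.inr ⟨i, Nat.lt_of_succ_lt_succ h⟩))

theorem joinEnv_map_succ {M : Struc.{u, w} L} {α' : Type} {σ' : α' → L.Sorts}
    {l' : List L.Sorts} {S : L.Sorts} (v' : ∀ i, M.carrier (σ' i))
    (x' : ∀ i, M.carrier (l'.get i)) (b : M.carrier S) (z : α' ⊕ Fin l'.length) :
    HEq (joinEnv M v' (consEnv M b x') (Sum.map id Fin.succ z)) (joinEnv M v' x' z) := by
  cases z <;> exact HEq.rfl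

theorem joinEnv_extendRenaming {M : Struc.{u, w} L} {α α' : Type} {σ : α → L.Sorts}
    {σ' : α' → L.Sorts} {l l' : List L.Sorts} {S : L.Sorts}
    {g : α ⊕ Fin l.length → α' ⊕ Fin l'.length} {v : ∀ i, M.carrier (σ i)}
    {x : ∀ i, M.carrier (l.get i)} {v' : ∀ i, M.carrier (σ' i)} {x' : ∀ i, M.carrier (l'.get i)}
    (h : ∀ i, HEq (joinEnv M v' x' (g i)) (joinEnv M v x i)) (b : M.carrier S) :
    ∀ i, HEq (joinEnv M v' (consEnv M b x') (extendRenaming S g i))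
      (joinEnv M v (consEnv M b x) i)
  | .inl i => (joinEnv_map_succ v' x' b _).trans (h (.inl i))
  | .inr ⟨0, _⟩ => HEq.rfl
  | .inr ⟨i + 1, hi⟩ =>
    (joinEnv_map_succ v' x' b _).trans (h (.inr ⟨i, Nat.lt_of_succ_lt_succ hi⟩))

/-- Variables can be renamed, and free variables exchanged for variables available for
quantification. The compatibility of the assignments is a heterogeneous equality because the sorts
agree only propositionally. The renamed formula is shown to exist rather than defined, so that no
casts enter the syntax. -/
theorem BFormula.exists_rename {α : Type} {σ : α → L.Sorts} {l : List L.Sorts}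
    (φ : BFormula L σ l) {α' : Type} {σ' : α' → L.Sorts} (l' : List L.Sorts)
    (g : α ⊕ Fin l.length → α' ⊕ Fin l'.length)
    (hg : ∀ i, Sum.elim σ' l'.get (g i) = Sum.elim σ l.get i) :
    ∃ ψ : BFormula L σ' l', ∀ (M : Struc.{u, w} L) (v : ∀ i, M.carrier (σ i))
      (x : ∀ i, M.carrier (l.get i)) (v' : ∀ i, M.carrier (σ' i))
      (x' : ∀ i, M.carrier (l'.get i)),
      (∀ i, HEq (joinEnv M v' x' (g i)) (joinEnv M v x i)) →
        ψ.eval M v' x' = φ.eval M v x := by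
  induction φ generalizing l' with
  | dist S s t =>
    obtain ⟨s', hs⟩ := Term.exists_rename.{u, w} g hg s
    obtain ⟨t', ht⟩ := Term.exists_rename.{u, w} g hg t
    refine ⟨.dist S s' t', fun M v x v' x' h => ?_⟩
    simp only [BFormula.eval]
    rw [hs M _ _ h, ht M _ _ h]
  | rel R ts =>
    choose ts' h' using fun i => Term.exists_rename.{u, w} g hg (ts i)
    refine ⟨.rel R ts', fun M v x v' x' h => ?_⟩
    simp only [BFormula.eval]
    congr 1
    funext i
    exact h' i M _ _ h
  | conn n c φ ih =>
    choose ψ hψ using fun i => ih i l' g hg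
    refine ⟨.conn n c ψ, fun M v x v' x' h => ?_⟩
    simp only [BFormula.eval]
    congr 1
    funext i
    exact hψ i M v x v' x' h
  | sup S φ ih =>
    obtain ⟨ψ, hψ⟩ := ih (S :: l') (extendRenaming S g) (sum_elim_extendRenaming S hg)
    refine ⟨.sup S ψ, fun M v x v' x' h => ?_⟩
    simp only [BFormula.eval]
    exact congrArg iSup (funext fun b => hψ M v _ v' _ (joinEnv_extendRenaming h b))
  | inf S φ ih =>
    obtain ⟨ψ, hψ⟩ := ih (S :: l') (extendRenaming S g) (sum_elim_extendRenaming S hg)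
    refine ⟨.inf S ψ, fun M v x v' x' h => ?_⟩
    simp only [BFormula.eval]
    exact congrArg iInf (funext fun b => hψ M v _ v' _ (joinEnv_extendRenaming h b))

/-- A formula in finitely many variables, one of which is distinguished, is equivalent to a formula
without variables reserved for quantification whose first variable is the distinguished one. -/
theorem BFormula.exists_formula_cons {α : Type} [Finite α] {σ : α → L.Sorts} {l : List L.Sorts}
    {S : L.Sorts} (φ : BFormula L σ (S :: l)) :
    ∃ (m : ℕ) (e : Fin m ≃ α ⊕ Fin l.length)
      (ψ : L.Formula (Fin.cons S fun j => Sum.elim σ l.get (e j) : Fin (m + 1) → L.Sorts)),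
      ∀ (M : Struc.{u, w} L) (v : ∀ i, M.carrier (σ i)) (x : ∀ i, M.carrier (l.get i))
        (b : M.carrier S), ψ.eval M (Fin.cons b fun j => joinEnv M v x (e j)) =
          φ.eval M v (consEnv M b x) := by
  obtain ⟨m, ⟨e'⟩⟩ := Finite.exists_equiv_fin (α ⊕ Fin l.length)
  let e := e'.symm
  let σ' : Fin (m + 1) → L.Sorts := Fin.cons S fun j => Sum.elim σ l.get (e j)
  let g : α ⊕ Fin (S :: l).length → Fin (m + 1) ⊕ Fin ([] : List L.Sorts).length := fun
    | .inl i => .inl (e.symm (.inl i)).succ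
    | .inr ⟨0, _⟩ => .inl 0
    | .inr ⟨i + 1, h⟩ => .inl (e.symm (.inr ⟨i, Nat.lt_of_succ_lt_succ h⟩)).succ
  have hg : ∀ i, Sum.elim σ' ([] : List L.Sorts).get (g i) = Sum.elim σ (S :: l).get i := by
    have h : ∀ z, Sum.elim σ l.get (e (e.symm z)) = Sum.elim σ l.get z := fun z => by
      rw [e.apply_symm_apply]
    rintro (i | ⟨_ | i, hi⟩)
    · exact h (.inl i)
    · rfl
    · exact h (.inr ⟨i, _⟩)
  obtain ⟨ψ, hψ⟩ := BFormula.exists_rename.{u, w} φ [] g hg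
  refine ⟨m, e, ψ, fun M v x b => hψ M v _ _ _ ?_⟩
  have h : ∀ z, HEq (joinEnv M v x (e (e.symm z))) (joinEnv M v x z) := fun z => by
    rw [e.apply_symm_apply]
  rintro (i | ⟨_ | i, hi⟩)
  · exact h (.inl i)
  · exact HEq.rfl
  · exact h (.inr ⟨i, Nat.lt_of_succ_lt_succ hi⟩)

/-! ### Elementary substructures -/

/-- A family of subsets of the sorts of a structure which contains approximate witnesses, for all
formulas in finitely many variables with parameters from the family. -/
def HasWitnesses (M : Struc.{u, w} L) (A : ∀ S, Set (M.carrier S)) : Prop :=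
  ∀ (m : ℕ) (σ : Fin (m + 1) → L.Sorts) (ψ : L.Formula σ) (a : ∀ j : Fin m, M.carrier (σ j.succ)),
    (∀ j, a j ∈ A _) → ∀ (b : M.carrier (σ 0)) (ε : ℝ), 0 < ε → ∃ b' ∈ A (σ 0),
      ψ.eval M (Fin.cons b' a) ≤ ψ.eval M (Fin.cons b a) + ε

theorem HasWitnesses.nonempty {M : Struc.{u, w} L} {A : ∀ S, Set (M.carrier S)}
    (h : HasWitnesses M A) (S : L.Sorts) : (A S).Nonempty := by
  obtain ⟨b, hb, -⟩ := h 0 (fun _ => S) (.conn 0 ⟨fun _ => 0, by fun_prop⟩ Fin.elim0) Fin.elim0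
    (fun j => j.elim0) (Classical.arbitrary (M.carrier S)) 1 one_pos
  exact ⟨b, hb⟩

/-- Closed families with approximate witnesses are closed under the function symbols: a witness for
the formula `d(f(a), y)` is close to `f(a)`. -/
theorem HasWitnesses.funMap_mem {M : Struc.{u, w} L} {A : ∀ S, Set (M.carrier S)}
    (h : HasWitnesses M A) (hc : ∀ S, IsClosed (A S)) (f : L.Functions)
    (a : ∀ i, M.carrier (L.funDom f i)) (ha : ∀ i, a i ∈ A _) : M.funMap f a ∈ A _ := by
  refine (hc _).closure_subset (Metric.mem_closure_iff.2 fun ε hε => ?_)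
  let σ : Fin (L.funArity f + 1) → L.Sorts := Fin.cons (L.funCod f) (L.funDom f)
  let x : ∀ i, Term L (Sum.elim σ ([] : List L.Sorts).get) (σ i) := fun i => .var (Sum.inl i)
  obtain ⟨b, hb, hb'⟩ := h (L.funArity f) σ
    (.dist (L.funCod f) (.func f fun i => x i.succ) (x 0)) a ha (M.funMap f a) (ε / 2) (half_pos hε)
  refine ⟨b, hb, ?_⟩
  have hb'' : dist (M.funMap f a) b ≤ dist (M.funMap f a) (M.funMap f a) + ε / 2 := hb'
  rw [dist_self] at hb''
  linarith

/-- The substructure on a family of closed subsets with approximate witnesses. -/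
def Struc.restrict (M : Struc.{u, w} L) (A : ∀ S, Set (M.carrier S)) (hc : ∀ S, IsClosed (A S))
    (h : HasWitnesses M A) : Struc.{u, w} L where
  carrier S := A S
  metric _ := inferInstance
  complete S := (hc S).completeSpace_coe
  nonempty S := (h.nonempty S).to_subtype
  dist_le S _ _ := M.dist_le S _ _
  funMap f a := ⟨M.funMap f fun i => a i, h.funMap_mem hc f _ fun i => (a i).2⟩
  funMap_unif f ε _ _ hab := M.funMap_unif f ε _ _ hab
  relMap R a := M.relMap R fun i => a i
  relMap_mem R _ := M.relMap_mem R _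
  relMap_unif R ε _ _ hab := M.relMap_unif R ε _ _ hab

section Restrict

variable {M : Struc.{u, w} L} {A : ∀ S, Set (M.carrier S)} (hc : ∀ S, IsClosed (A S))
  (h : HasWitnesses M A)

/-- The inclusion of a substructure. -/
def restrictEmbedding : Embedding (M.restrict A hc h) M where
  toFun _ a := a.1
  map_dist _ _ _ := rfl
  map_fun _ _ := rfl
  map_rel _ _ := rfl

theorem restrictEmbedding_tarskiVaught {α : Type} [Finite α] (σ : α → L.Sorts) :
    (restrictEmbedding hc h).TarskiVaught σ := by
  intro l S φ v x b ε hε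
  obtain ⟨m, e, ψ, hψ⟩ := BFormula.exists_formula_cons.{u, w} φ
  obtain ⟨b', hb', hle⟩ := h m _ ψ
    (fun j => joinEnv M (fun i => (v i).1) (fun i => (x i).1) (e j)) (fun j => by
      have key : ∀ z, joinEnv M (fun i => (v i).1) (fun i => (x i).1) z ∈ A _ := by
        rintro (i | i)
        · exact (v i).2
        · exact (x i).2
      exact key (e j)) b ε hε
  refine ⟨⟨b', hb'⟩, ?_⟩
  have h₁ := hψ M (fun i => (v i).1) (fun i => (x i).1) b'
  have h₂ := hψ M (fun i => (v i).1) (fun i => (x i).1) b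
  exact (h₁.symm.le.trans hle).trans_eq (congrArg (· + ε) h₂)

theorem models_restrict {T : Set L.Sentence} (hM : Models M T) : Models (M.restrict A hc h) T := by
  intro φ hφ
  rw [← hM φ hφ, Sentence.value, Sentence.value,
    (restrictEmbedding_tarskiVaught hc h _).formula_eval_eq φ]
  congr 1
  funext k
  exact k.elim

end Restrict

/-! ### Skolem hulls -/

theorem exists_dense_card_eq (X : Type w) [TopologicalSpace X] :
    ∃ D : Set X, Dense D ∧ #D = densityCharacter X := by
  have : Nonempty {D : Set X // Dense D} := ⟨⟨Set.univ, dense_univ⟩⟩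
  obtain ⟨D, hD⟩ := ciInf_mem fun D : {D : Set X // Dense D} => #D.1
  exact ⟨D.1, D.2, hD⟩

theorem densityCharacter_le {X : Type w} [TopologicalSpace X] {D : Set X} (hD : Dense D) :
    densityCharacter X ≤ #D :=
  ciInf_le' (fun D : {D : Set X // Dense D} => #D.1) ⟨D, hD⟩

theorem one_le_densityCharacter (X : Type w) [TopologicalSpace X] [Nonempty X] :
    1 ≤ densityCharacter X := by
  obtain ⟨D, hD, hcard⟩ := exists_dense_card_eq X
  rw [← hcard, Cardinal.one_le_iff_ne_zero, Cardinal.mk_ne_zero_iff]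
  exact hD.nonempty.to_subtype

section Skolem

variable {T : Set L.Sentence}

instance {α : Type} (σ : α → L.Sorts) : Nonempty (FormulaSpace T σ) :=
  ⟨⟨.conn 0 ⟨fun _ => 0, by fun_prop⟩ Fin.elim0⟩⟩

/-- Each space of formulas contributes at least `1` to the sum of density characters, so that there
are only countably many tuples of sorts. -/
theorem SeparableRelativeTo.countable_sorts (h : SeparableRelativeTo T) :
    Countable (Σ n : ℕ, Fin n → L.Sorts) := by
  rw [← Cardinal.mk_le_aleph0_iff]
  refine le_trans ?_ h
  rw [languageDensityCharacter]
  refine le_trans (le_of_eq ?_) (Cardinal.sum_le_sum (fun _ => 1) _ fun x =>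
    one_le_densityCharacter _)
  simp

theorem SeparableRelativeTo.exists_countable_dense (h : SeparableRelativeTo T) (n : ℕ)
    (σ : Fin n → L.Sorts) : ∃ D : Set (FormulaSpace T σ), D.Countable ∧ Dense D := by
  obtain ⟨D, hD, hcard⟩ := exists_dense_card_eq (FormulaSpace T σ)
  refine ⟨D, ?_, hD⟩
  rw [← Cardinal.le_aleph0_iff_set_countable, hcard]
  exact (Cardinal.le_sum (fun x : (Σ n : ℕ, Fin n → L.Sorts) =>
    densityCharacter (FormulaSpace T x.2)) ⟨n, σ⟩).trans h

theorem FormulaSpace.abs_eval_sub_le {α : Type} {σ : α → L.Sorts} {φ ψ : FormulaSpace T σ} {ε : ℝ}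
    (h : edist φ ψ < ENNReal.ofReal ε) (M : Mod T) (a : ∀ i, M.1.carrier (σ i)) :
    |φ.formula.eval M.1 a - ψ.formula.eval M.1 a| ≤ ε := by
  have h₁ : edist (φ.formula.eval M.1 a) (ψ.formula.eval M.1 a) ≤ edist φ ψ := by
    change _ ≤ theoryNorm T (φ.formula.sub ψ.formula)
    rw [theoryNorm_sub]
    exact le_iSup₂ (f := fun (M : Mod T) (a : ∀ i, M.1.carrier (σ i)) =>
      edist (φ.formula.eval M.1 a) (ψ.formula.eval M.1 a)) M a
  have h₂ := (edist_lt_ofReal.1 (h₁.trans_lt h)).le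
  rwa [Real.dist_eq] at h₂

theorem exists_skolem (M : Struc.{u, w} L) {m : ℕ} {σ : Fin (m + 1) → L.Sorts} (ψ : L.Formula σ)
    (a : ∀ j : Fin m, M.carrier (σ j.succ)) (k : ℕ) : ∃ b' : M.carrier (σ 0), ∀ b,
      ψ.eval M (Fin.cons b' a) ≤ ψ.eval M (Fin.cons b a) + 1 / (k + 1 : ℝ) := by
  obtain ⟨C, hC⟩ := BFormula.exists_bound.{u, w} ψ
  have hbdd : BddBelow (Set.range fun b => ψ.eval M (Fin.cons b a)) :=
    ⟨-C, by rintro _ ⟨b, rfl⟩; exact (abs_le.1 (hC M _ _)).1⟩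
  obtain ⟨b', hb'⟩ := exists_lt_of_ciInf_lt
    (lt_add_of_pos_right (⨅ b, ψ.eval M (Fin.cons b a)) (Nat.one_div_pos_of_nat (α := ℝ) (n := k)))
  exact ⟨b', fun b => hb'.le.trans (by linarith [ciInf_le hbdd b])⟩

/-- The approximate Skolem function of a formula: a value of the first variable at which the formula,
with the given parameters, exceeds its infimum by at most `1 / (k + 1)`. -/
def skolem (M : Struc.{u, w} L) {m : ℕ} {σ : Fin (m + 1) → L.Sorts} (ψ : L.Formula σ)
    (a : ∀ j : Fin m, M.carrier (σ j.succ)) (k : ℕ) : M.carrier (σ 0) :=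
  (exists_skolem M ψ a k).choose

/-- The one-sorted first-order language of the approximate Skolem functions of the formulas from
given sets. -/
def skolemLanguage (D : ∀ (n : ℕ) (σ : Fin n → L.Sorts), Set (FormulaSpace T σ)) :
    FirstOrder.Language.{u, 0} where
  Functions m := Σ σ : Fin (m + 1) → L.Sorts, D (m + 1) σ × ℕ
  Relations _ := Empty

variable (D : ∀ (n : ℕ) (σ : Fin n → L.Sorts), Set (FormulaSpace T σ)) (M : Struc.{u, u} L)

open Classical in
/-- The Skolem functions act on the disjoint union of the sorts; at tuples of the wrong sorts they
take an arbitrary value. -/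
instance skolemStructure : (skolemLanguage D).Structure (Σ S, M.carrier S) where
  funMap F y :=
    if h : ∀ j, (y j).1 = F.1 j.succ then
      ⟨F.1 0, skolem M F.2.1.1.formula (fun j => h j ▸ (y j).2) F.2.2⟩
    else ⟨F.1 0, Classical.arbitrary _⟩
  RelMap r _ := r.elim

/-- The closure of a set under the Skolem functions of the formulas from given sets. -/
def skolemHull (s : Set (Σ S, M.carrier S)) : Set (Σ S, M.carrier S) :=
  FirstOrder.Language.Substructure.closure (skolemLanguage D) s

variable {D M}

theorem subset_skolemHull (s : Set (Σ S, M.carrier S)) : s ⊆ skolemHull D M s :=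
  FirstOrder.Language.Substructure.subset_closure

theorem skolemHull_mono {s t : Set (Σ S, M.carrier S)} (h : s ⊆ t) :
    skolemHull D M s ⊆ skolemHull D M t :=
  FirstOrder.Language.Substructure.closure_mono h

theorem skolem_mem_skolemHull {s : Set (Σ S, M.carrier S)} {m : ℕ} {σ : Fin (m + 1) → L.Sorts}
    {ψ : FormulaSpace T σ} (hψ : ψ ∈ D (m + 1) σ) {a : ∀ j : Fin m, M.carrier (σ j.succ)}
    (ha : ∀ j, (⟨_, a j⟩ : Σ S, M.carrier S) ∈ skolemHull D M s) (k : ℕ) :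
    (⟨σ 0, skolem M ψ.formula a k⟩ : Σ S, M.carrier S) ∈ skolemHull D M s := by
  let F : (skolemLanguage D).Functions m := ⟨σ, ⟨ψ, hψ⟩, k⟩
  have h := (FirstOrder.Language.Substructure.closure (skolemLanguage D) s).fun_mem F
    (fun j => ⟨_, a j⟩) ha
  have e : FirstOrder.Language.Structure.funMap F (fun j => (⟨_, a j⟩ : Σ S, M.carrier S)) =
      ⟨σ 0, skolem M ψ.formula a k⟩ := dif_pos fun _ => rfl
  exact e ▸ h

/-- Skolem hulls are finitary: a hull of the union of a chain is the union of the hulls. -/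
theorem exists_mem_skolemHull_Iio {ι : Type*} [LinearOrder ι] [NoMaxOrder ι] [Nonempty ι]
    (c : ι → Set (Σ S, M.carrier S)) {y : Σ S, M.carrier S} (hy : y ∈ skolemHull D M (⋃ i, c i)) :
    ∃ i, y ∈ skolemHull D M (⋃ j ∈ Set.Iio i, c j) := by
  refine FirstOrder.Language.Substructure.closure_induction
    (p := fun y => ∃ i, y ∈ skolemHull D M (⋃ j ∈ Set.Iio i, c j)) hy ?_ ?_
  · intro x hx
    obtain ⟨j, hj⟩ := Set.mem_iUnion.1 hx
    obtain ⟨i, hi⟩ := exists_gt j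
    exact ⟨i, subset_skolemHull _ (Set.mem_biUnion hi hj)⟩
  · intro n F x hx
    choose i hi using hx
    obtain ⟨i₀, h₀⟩ := Finite.exists_le i
    refine ⟨i₀, FirstOrder.Language.Substructure.fun_mem _ F x fun k =>
      skolemHull_mono (Set.biUnion_mono (Set.Iio_subset_Iio (h₀ k)) fun _ _ => subset_rfl) (hi k)⟩

theorem card_skolemHull_le (hT : Countable (Σ n : ℕ, Fin n → L.Sorts))
    (hD : ∀ n σ, (D n σ).Countable) (s : Set (Σ S, M.carrier S)) :
    #(skolemHull D M s) ≤ max ℵ₀ #s := by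
  have hF : Countable (Σ m, (skolemLanguage D).Functions m) := by
    have : ∀ n σ, Countable (D n σ) := fun n σ => (hD n σ).to_subtype
    let f : (Σ m, (skolemLanguage D).Functions m) →
        Σ x : (Σ n : ℕ, Fin n → L.Sorts), D x.1 x.2 × ℕ := fun F => ⟨⟨F.1 + 1, F.2.1⟩, F.2.2⟩
    have hf : Function.Injective f := by
      rintro ⟨m, σ, p⟩ ⟨m', σ', p'⟩ h
      simp only [f, Sigma.mk.injEq] at h
      obtain ⟨⟨h₁, h₂⟩, h₃⟩ := h
      obtain rfl : m = m' := Nat.succ_injective h₁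
      obtain rfl := eq_of_heq h₂
      obtain rfl := eq_of_heq h₃
      rfl
    exact hf.countable
  have h := FirstOrder.Language.Substructure.lift_card_closure_le (L := skolemLanguage D) (s := s)
  simp only [Cardinal.lift_id] at h
  refine h.trans (max_le (le_max_left _ _) ?_)
  refine (Cardinal.add_le_max _ _).trans (max_le (max_le (le_max_right _ _) ?_) (le_max_left _ _))
  exact (Cardinal.mk_le_aleph0_iff.2 hF).trans (le_max_left _ _)

/-- The closed subset of each sort generated by a set. -/
def closedHull (D : ∀ (n : ℕ) (σ : Fin n → L.Sorts), Set (FormulaSpace T σ)) (M : Struc.{u, u} L)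
    (s : Set (Σ S, M.carrier S)) (S : L.Sorts) : Set (M.carrier S) :=
  closure {b | (⟨S, b⟩ : Σ S, M.carrier S) ∈ skolemHull D M s}

/-- Closed hulls under Skolem functions of a dense set of formulas are elementary substructures. -/
theorem hasWitnesses_closedHull (hD : ∀ n σ, Dense (D n σ)) (M : Mod T)
    (s : Set (Σ S, M.1.carrier S)) : HasWitnesses M.1 (closedHull D M.1 s) := by
  intro m σ ψ a ha b ε hε
  have hε' : 0 < ε / 5 := by positivity
  obtain ⟨χ, hχD, hχ⟩ := (EMetric.dense_iff.1 (hD (m + 1) σ)) ⟨ψ⟩ (ENNReal.ofReal (ε / 5))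
    (ENNReal.ofReal_pos.2 hε')
  have hχ' := FormulaSpace.abs_eval_sub_le hχD M
  obtain ⟨δ, hδ, hmod⟩ := BFormula.exists_modulus.{u, u} ψ hε'
  choose a' ha' hdist using fun j => Metric.mem_closure_iff.1 (ha j) δ hδ
  obtain ⟨k, hk⟩ := exists_nat_one_div_lt hε'
  -- The parameters lie only in the closure of the hull: they are replaced by parameters `a'` in the
  -- hull, and `ψ` by a formula `χ` from the dense set, each exchange costing `ε / 5`.
  have hcons : ∀ b₀, |ψ.eval M.1 (Fin.cons b₀ a) - ψ.eval M.1 (Fin.cons b₀ a')| ≤ ε / 5 :=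
    fun b₀ => hmod M.1 _ _ _ _ (fun i => by
      refine Fin.cases ?_ (fun j => ?_) i
      · simpa using hδ
      · simpa using hdist j) fun i => i.elim0
  refine ⟨skolem M.1 χ.formula a' k, subset_closure (skolem_mem_skolemHull hχ ha' k), ?_⟩
  have h₁ := (exists_skolem M.1 χ.formula a' k).choose_spec b
  have h₂ := abs_le.1 (hcons (skolem M.1 χ.formula a' k))
  have h₃ := abs_le.1 (hcons b)
  have h₄ := abs_le.1 (hχ' (Fin.cons (skolem M.1 χ.formula a' k) a'))
  have h₅ := abs_le.1 (hχ' (Fin.cons b a'))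
  change χ.formula.eval M.1 (Fin.cons (skolem M.1 χ.formula a' k) a') ≤ _ at h₁
  dsimp only at h₄ h₅
  linarith [h₂.1, h₂.2, h₃.1, h₃.2, h₄.1, h₄.2, h₅.1, h₅.2]

end Skolem

/-! ### Definable predicates -/

section Predicates

variable {T : Set L.Sentence} {α : Type} {σ : α → L.Sorts}

/-- Definable predicates are uniform limits of formulas, uniformly over all models. -/
theorem DefinablePredicate.exists_formula (P : DefinablePredicate T σ) {ε : ℝ} (hε : 0 < ε) :
    ∃ ψ : L.Formula σ, ∀ (M : Mod T) (a : ∀ i, M.1.carrier (σ i)),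
      |P.eval M a - ψ.eval M.1 a| ≤ ε := by
  let F : Filter (FormulaSpace T σ) := comap (↑) (𝓝 P)
  have : F.NeBot := UniformSpace.Completion.isDenseInducing_coe.comap_nhds_neBot P
  have hF : Cauchy F := cauchy_nhds.comap'
    (UniformSpace.Completion.isUniformInducing_coe _).comap_uniformity.le this
  obtain ⟨t, ht, hd⟩ := EMetric.cauchy_iff.1 hF |>.2 (ENNReal.ofReal ε) (ENNReal.ofReal_pos.2 hε)
  obtain ⟨ψ, hψ⟩ := nonempty_of_mem ht
  refine ⟨ψ.formula, fun M a => ?_⟩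
  have h₁ : Tendsto (fun χ : FormulaSpace T σ => χ.formula.eval M.1 a) F (𝓝 (P.eval M a)) := by
    have hc : Continuous fun Q : DefinablePredicate T σ => Q.eval M a :=
      UniformSpace.Completion.continuous_extension
    exact ((hc.tendsto P).comp tendsto_comap).congr fun χ => DefinablePredicate.eval_coe χ M a
  refine le_of_tendsto (h₁.sub_const _).abs ?_
  filter_upwards [ht] with χ hχ
  exact FormulaSpace.abs_eval_sub_le (hd χ hχ ψ hψ) M a

theorem Embedding.TarskiVaught.predicate_eval_eq {N M : Mod T} {ρ : Embedding N.1 M.1}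
    (hρ : ρ.TarskiVaught σ) (P : DefinablePredicate T σ) (a : ∀ i, N.1.carrier (σ i)) :
    P.eval N a = P.eval M fun i => ρ.toFun _ (a i) := by
  refine eq_of_forall_dist_le fun ε hε => ?_
  obtain ⟨ψ, hψ⟩ := P.exists_formula (half_pos hε)
  have h₁ := abs_le.1 (hψ N a)
  have h₂ := abs_le.1 (hψ M fun i => ρ.toFun _ (a i))
  rw [hρ.formula_eval_eq ψ a] at h₁
  rw [Real.dist_eq, abs_le]
  constructor <;> linarith [h₁.1, h₁.2, h₂.1, h₂.2]

variable {I : Type}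

/-- The ultrapower of a model of `T`, as a model of `T`. -/
def Mod.ultrapower (N : Mod T) (U : Ultrafilter I) : Mod T :=
  ⟨N.1.ultrapower U, models_ultraproduct (fun _ => N.1) U fun _ => N.2⟩

/-- The class in the ultrapower of a family of elements. -/
def Mod.ultraMk (N : Mod T) (U : Ultrafilter I) {S : L.Sorts} (a : I → N.1.carrier S) :
    (N.ultrapower U).1.carrier S :=
  MetricLanguage.ultraMk (fun _ => N.1) U a

theorem DefinablePredicate.tendsto_eval_ultrapower (P : DefinablePredicate T σ) (N : Mod T)
    (U : Ultrafilter I) (v : ∀ k, I → N.1.carrier (σ k)) :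
    Tendsto (fun i => P.eval N fun k => v k i) U
      (𝓝 (P.eval (N.ultrapower U) fun k => N.ultraMk U (v k))) := by
  refine Metric.tendsto_nhds.2 fun ε hε => ?_
  have hε' : 0 < ε / 4 := by positivity
  obtain ⟨ψ, hψ⟩ := P.exists_formula hε'
  filter_upwards [Metric.tendsto_nhds.1
    (tendsto_formula_eval_ultraproduct (fun _ => N.1) U ψ v) (ε / 4) hε'] with i hi
  have h₁ := abs_le.1 (hψ N fun k => v k i)
  have h₂ := abs_le.1 (hψ (N.ultrapower U) fun k => N.ultraMk U (v k))
  rw [Real.dist_eq, abs_lt] at hi ⊢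
  have h₃ : -(ε / 4) < ψ.eval N.1 (fun k => v k i) -
    ψ.eval (N.ultrapower U).1 (fun k => N.ultraMk U (v k)) := hi.1
  have h₄ : ψ.eval N.1 (fun k => v k i) -
    ψ.eval (N.ultrapower U).1 (fun k => N.ultraMk U (v k)) < ε / 4 := hi.2
  constructor <;> linarith [h₁.1, h₁.2, h₂.1, h₂.2]

end Predicates

/-! ### Definable sets -/

section DefinableSets

variable {T : Set L.Sentence} {X : UniformAssignment T}

/-- A nonempty definable set is the zero set of its distance predicate. Nonemptiness is needed as
`infDist` to the empty set is `0`. -/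
theorem UniformAssignment.mem_iff {P : DefinablePredicate T X.sorts}
    (hP : ∀ (M : Mod T) a, P.eval M a = Metric.infDist a (X.set M))
    (hne : ∀ M, (X.set M).Nonempty) (M : Mod T) (a : ∀ i, M.1.carrier (X.sorts i)) :
    a ∈ X.set M ↔ P.eval M a = 0 := by
  rw [hP, (X.isClosed M).mem_iff_infDist_zero (hne M)]

theorem UniformAssignment.IsDefinable.mem_comp_iff (hX : X.IsDefinable)
    (hne : ∀ M, (X.set M).Nonempty) {N M : Mod T} {ρ : Embedding N.1 M.1}
    (hρ : ρ.TarskiVaught X.sorts) (a : ∀ i, N.1.carrier (X.sorts i)) :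
    (fun i => ρ.toFun _ (a i)) ∈ X.set M ↔ a ∈ X.set N := by
  obtain ⟨P, hP⟩ := hX
  rw [X.mem_iff hP hne, X.mem_iff hP hne, hρ.predicate_eval_eq P a]

variable {I : Type}

theorem UniformAssignment.IsDefinable.ultraMk_mem (hX : X.IsDefinable)
    (hne : ∀ M, (X.set M).Nonempty) {N : Mod T} (U : Ultrafilter I)
    {v : I → ∀ k, N.1.carrier (X.sorts k)} (hv : ∀ i, v i ∈ X.set N) :
    (fun k => N.ultraMk U fun i => v i k) ∈ X.set (N.ultrapower U) := by
  obtain ⟨P, hP⟩ := hX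
  rw [X.mem_iff hP hne]
  refine tendsto_nhds_unique (P.tendsto_eval_ultrapower N U fun k i => v i k) ?_
  exact (tendsto_congr fun i => (X.mem_iff hP hne N (v i)).1 (hv i)).2 tendsto_const_nhds

/-- The points of a definable set in an ultrapower are represented by families of points of the
definable set. -/
theorem UniformAssignment.IsDefinable.exists_rep (hX : X.IsDefinable)
    (hne : ∀ M, (X.set M).Nonempty) {N : Mod T} {U : Ultrafilter I}
    {x : ∀ k, (N.ultrapower U).1.carrier (X.sorts k)} (hx : x ∈ X.set (N.ultrapower U)) :
    ∃ v : I → ∀ k, N.1.carrier (X.sorts k), (∀ i, v i ∈ X.set N) ∧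
      x = fun k => N.ultraMk U fun i => v i k := by
  obtain ⟨P, hP⟩ := hX
  let r : ∀ k, I → N.1.carrier (X.sorts k) := fun k => ultraRep (fun _ => N.1) U (x k)
  have hr : (fun k => N.ultraMk U (r k)) = x := funext fun k => ultraMk_rep (x k)
  -- A point is moved by at most twice its distance to `X(N)`; a point of `X(N)` is not moved, so
  -- that no error term has to vanish along `U`.
  have hnear : ∀ a : ∀ k, N.1.carrier (X.sorts k), ∃ b ∈ X.set N, dist a b ≤ 2 * P.eval N a := by
    intro a
    rcases (hP N a ▸ Metric.infDist_nonneg : 0 ≤ P.eval N a).eq_or_lt with h | h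
    · exact ⟨a, (X.mem_iff hP hne N a).2 h.symm, by rw [dist_self, ← h, mul_zero]⟩
    · obtain ⟨b, hb, hlt⟩ := (Metric.infDist_lt_iff (hne N)).1
        (show Metric.infDist a (X.set N) < 2 * P.eval N a by rw [← hP]; linarith)
      exact ⟨b, hb, hlt.le⟩
  choose v hv hdist using fun i => hnear fun k => r k i
  refine ⟨v, hv, ?_⟩
  have h₀ : Tendsto (fun i => 2 * P.eval N fun k => r k i) U (𝓝 0) := by
    have h := (P.tendsto_eval_ultrapower N U r).const_mul 2
    rwa [hr, (X.mem_iff hP hne _ x).1 hx, mul_zero] at h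
  funext k
  rw [← hr]
  refine eq_of_dist_eq_zero (tendsto_nhds_unique (tendsto_dist (fun _ => N.1) U _ _ _)
    (squeeze_zero (fun i => dist_nonneg) (fun i => ?_) h₀))
  exact (dist_le_pi_dist (fun k => r k i) (v i) k).trans (hdist i)

theorem pairEnv_ultraMk {N : Mod T} {U : Ultrafilter I} {n : ℕ} {σ : Fin n → L.Sorts}
    (a b : I → ∀ k, N.1.carrier (σ k)) :
    pairEnv (M := (N.ultrapower U).1) (fun k => N.ultraMk U fun i => a i k)
        (fun k => N.ultraMk U fun i => b i k) =
      fun k => N.ultraMk U fun i => pairEnv (M := N.1) (a i) (b i) k := by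
  funext k
  cases k <;> rfl

theorem pairEnv_comp {N M : Struc.{u, w} L} (ρ : Embedding N M) {n : ℕ} {σ : Fin n → L.Sorts}
    (a b : ∀ k, N.carrier (σ k)) :
    pairEnv (fun k => ρ.toFun _ (a k)) (fun k => ρ.toFun _ (b k)) =
      fun k => ρ.toFun _ (pairEnv a b k) := by
  funext k
  cases k <;> rfl

theorem eval_pairEnv_ultraMk_eq_zero {N : Mod T} {U : Ultrafilter I} {n : ℕ}
    {σ : Fin n → L.Sorts} (φ : DefinablePredicate T (Sum.elim σ σ))
    {a b : I → ∀ k, N.1.carrier (σ k)}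
    (h : ∀ᶠ i in (U : Filter I), φ.eval N (pairEnv (a i) (b i)) = 0) :
    φ.eval (N.ultrapower U) (pairEnv (fun k => N.ultraMk U fun i => a i k)
      fun k => N.ultraMk U fun i => b i k) = 0 := by
  rw [pairEnv_ultraMk]
  refine tendsto_nhds_unique
    (φ.tendsto_eval_ultrapower N U fun k i => pairEnv (M := N.1) (a i) (b i) k) ?_
  exact (tendsto_congr' h).2 tendsto_const_nhds

/-! ### A model in which small families are bounded -/

variable {φ : DefinablePredicate T (Sum.elim X.sorts X.sorts)}

theorem exists_bound_finset
    (hbound : ∀ (M : Mod T) (n : ℕ) (a : Fin n → ∀ i, M.1.carrier (X.sorts i)),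
      (∀ j, a j ∈ X.set M) → ∃ b ∈ X.set M, ∀ j, φ.eval M (pairEnv (a j) b) = 0)
    (M : Mod T) {J : Type*} (F : Finset J) (a : J → ∀ i, M.1.carrier (X.sorts i))
    (ha : ∀ j, a j ∈ X.set M) : ∃ b ∈ X.set M, ∀ j ∈ F, φ.eval M (pairEnv (a j) b) = 0 := by
  obtain ⟨b, hb, h⟩ := hbound M F.card (fun j => a (F.equivFin.symm j)) fun j => ha _
  refine ⟨b, hb, fun j hj => ?_⟩
  simpa using h (F.equivFin ⟨j, hj⟩)

/-- There is a model in which all families indexed by `J` of points of the definable set are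
bounded: an ultrapower with respect to an ultrafilter on the finite subsets of `J` which contains
all cones. In the coordinate `F`, a bound of the finitely many members of the family with index in
`F` is taken. -/
theorem exists_model_bounding (hT : IsTheory T) (hX : X.IsDefinable)
    (hne : ∀ M, (X.set M).Nonempty)
    (hbound : ∀ (M : Mod T) (n : ℕ) (a : Fin n → ∀ i, M.1.carrier (X.sorts i)),
      (∀ j, a j ∈ X.set M) → ∃ b ∈ X.set M, ∀ j, φ.eval M (pairEnv (a j) b) = 0)
    (J : Type) : ∃ M : Mod T, ∀ a : J → X.set M, ∃ b ∈ X.set M, ∀ j,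
      φ.eval M (pairEnv (a j).1 b) = 0 := by
  classical
  obtain ⟨N⟩ := hT
  let U : Ultrafilter (Finset J) := Ultrafilter.of atTop
  refine ⟨N.ultrapower U, fun a => ?_⟩
  choose v hv hav using fun j => hX.exists_rep hne (a j).2
  choose b hb hle using fun F : Finset J => exists_bound_finset hbound N F (fun j => v j F)
    fun j => hv j F
  refine ⟨_, hX.ultraMk_mem hne U hb, fun j => ?_⟩
  rw [hav j]
  refine eval_pairEnv_ultraMk_eq_zero φ ?_
  have h : ∀ᶠ F : Finset J in atTop, j ∈ F :=
    (eventually_ge_atTop {j}).mono fun F hF => hF (Finset.mem_singleton_self j)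
  exact (h.filter_mono (Ultrafilter.of_le atTop)).mono fun F hF => hle F j hF

/-! ### Models with a scale -/

/-- A scale of `X(M)`: a family indexed by a linear order, every point of `X(M)` being eventually
below its members in the sense of the relation `φ = 0`. -/
structure IsScale (φ : DefinablePredicate T (Sum.elim X.sorts X.sorts)) (M : Mod T) {ι : Type}
    [LinearOrder ι] (c : ι → ∀ k, M.1.carrier (X.sorts k)) : Prop where
  mem : ∀ i, c i ∈ X.set M
  exists_forall_ge : ∀ x ∈ X.set M, ∃ i, ∀ j, i ≤ j → φ.eval M (pairEnv x (c j)) = 0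

/-- The constant families over a scale form a scale of an ultrapower, provided that the index set of
the ultrapower has no unbounded image in that of the scale. -/
theorem IsScale.ultrapower (hX : X.IsDefinable) (hne : ∀ M, (X.set M).Nonempty) {M : Mod T}
    {ι : Type} [LinearOrder ι] {c : ι → ∀ k, M.1.carrier (X.sorts k)} (hc : IsScale φ M c)
    (hι : ∀ f : I → ι, ∃ i, ∀ k, f k < i) (U : Ultrafilter I) :
    IsScale φ (M.ultrapower U) fun i k => M.ultraMk U fun _ => c i k where
  mem i := hX.ultraMk_mem hne U (v := fun _ => c i) fun _ => hc.mem i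
  exists_forall_ge x hx := by
    obtain ⟨v, hv, rfl⟩ := hX.exists_rep hne hx
    choose t ht using fun k => hc.exists_forall_ge (v k) (hv k)
    obtain ⟨i, hi⟩ := hι t
    exact ⟨i, fun j hj => eval_pairEnv_ultraMk_eq_zero φ (b := fun _ => c j)
      (Eventually.of_forall fun k => ht k j ((hi k).le.trans hj))⟩

/-- Models with scales of different cofinalities are not isomorphic. -/
theorem IsScale.not_isomorphic (hX : X.IsDefinable) (hne : ∀ M, (X.set M).Nonempty)
    (hasymm : ∀ M : Mod T, ∀ a ∈ X.set M, ∀ b ∈ X.set M,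
      φ.eval M (pairEnv a b) = 0 → φ.eval M (pairEnv b a) = 1)
    {N M : Mod T} {ι κ : Type} [LinearOrder ι] [LinearOrder κ]
    {c : ι → ∀ k, N.1.carrier (X.sorts k)} {d : κ → ∀ k, M.1.carrier (X.sorts k)}
    (hc : IsScale φ N c) (hd : IsScale φ M d) (hικ : ∀ f : ι → κ, ∃ i, ∀ k, f k < i) :
    ¬ Isomorphic N.1 M.1 := by
  rintro ⟨ρ, hρ⟩
  have hmem := fun a => hX.mem_comp_iff hne (hρ.tarskiVaught X.sorts) a
  choose t ht using fun i => hd.exists_forall_ge _ ((hmem (c i)).2 (hc.mem i))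
  obtain ⟨j, hj⟩ := hικ t
  choose b hb using fun k => hρ _ (d j k)
  have hb' : (fun k => ρ.toFun _ (b k)) = d j := funext hb
  have hbX : b ∈ X.set N := (hmem b).1 (hb' ▸ hd.mem j)
  obtain ⟨i, hi⟩ := hc.exists_forall_ge b hbX
  have h₁ := hasymm N _ hbX _ (hc.mem i) (hi i le_rfl)
  have h₂ := ht i j (hj i).le
  rw [← hb', pairEnv_comp, ← (hρ.tarskiVaught _).predicate_eval_eq φ, h₁] at h₂
  exact one_ne_zero h₂

/-! ### Closed hulls of families of tuples -/

/-- Recursive choice along a well-order. -/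
theorem exists_forall_of_forall_exists {ι : Type*} [LinearOrder ι] [WellFoundedLT ι] {Z : Type*}
    (R : ∀ i : ι, (Set.Iio i → Z) → Z → Prop) (h : ∀ i g, ∃ z, R i g z) :
    ∃ c : ι → Z, ∀ i, R i (fun j => c j) (c i) := by
  let F : ∀ i : ι, (∀ j, j < i → Z) → Z := fun i g => (h i fun j => g j.1 j.2).choose
  refine ⟨wellFounded_lt.fix F, fun i => ?_⟩
  rw [wellFounded_lt.fix_eq F i]
  exact (h i _).choose_spec

/-- The generators of the hull of a tuple. -/
def tuplePoints {M : Struc.{u, w} L} {n : ℕ} {σ : Fin n → L.Sorts} (t : ∀ k, M.carrier (σ k)) :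
    Set (Σ S, M.carrier S) :=
  Set.range fun k => ⟨σ k, t k⟩

theorem card_iUnion_tuplePoints_le {M : Struc.{u, u} L} {n : ℕ} {σ : Fin n → L.Sorts} {κ : Type}
    (hκ : #κ ≤ 𝔠) (g : κ → ∀ k, M.carrier (σ k)) : #(⋃ j, tuplePoints (g j) : Set _) ≤ 𝔠 := by
  have h : (⋃ j, tuplePoints (g j)) =
      Set.range fun p : κ × Fin n => (⟨σ p.2, g p.1 p.2⟩ : Σ S, M.carrier S) := by
    ext y
    simp [tuplePoints]
  rw [h]
  have h₁ := Cardinal.mk_range_le_lift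
    (f := fun p : κ × Fin n => (⟨σ p.2, g p.1 p.2⟩ : Σ S, M.carrier S))
  rw [Cardinal.lift_id'.{0, u}] at h₁
  refine h₁.trans ?_
  rw [← Cardinal.lift_continuum.{u, 0}, Cardinal.lift_le, Cardinal.mk_prod]
  simp only [Cardinal.lift_id]
  refine (Cardinal.mul_le_max _ _).trans (max_le (max_le hκ ?_) Cardinal.aleph0_le_continuum)
  exact (Cardinal.mk_le_aleph0).trans Cardinal.aleph0_le_continuum

section Hull

variable {D : ∀ (n : ℕ) (σ : Fin n → L.Sorts), Set (FormulaSpace T σ)} {M : Struc.{u, u} L}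

/-- A point of a closed hull is determined by a sequence in the hull, so that there are at most
`𝔠 ^ ℵ₀ = 𝔠` tuples in a closed hull with at most `𝔠` generators. -/
theorem card_tuples_closedHull_le (hT : Countable (Σ n : ℕ, Fin n → L.Sorts))
    (hD : ∀ n σ, (D n σ).Countable) {s : Set (Σ S, M.carrier S)} (hs : #s ≤ 𝔠) {n : ℕ}
    (σ : Fin n → L.Sorts) :
    #{x : ∀ k, M.carrier (σ k) | ∀ k, x k ∈ closedHull D M s (σ k)} ≤ 𝔠 := by
  have hH : #(skolemHull D M s) ≤ 𝔠 :=
    (card_skolemHull_le hT hD s).trans (max_le Cardinal.aleph0_le_continuum hs)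
  have happ : ∀ (x : {x : ∀ k, M.carrier (σ k) | ∀ k, x k ∈ closedHull D M s (σ k)})
      (p : Fin n × ℕ), ∃ d : M.carrier (σ p.1), (⟨σ p.1, d⟩ : Σ S, M.carrier S) ∈ skolemHull D M s ∧
        dist (x.1 p.1) d < 1 / (p.2 + 1 : ℝ) := fun x p => by
    obtain ⟨d, hd, hlt⟩ := Metric.mem_closure_iff.1 (x.2 p.1) _
      (Nat.one_div_pos_of_nat (α := ℝ) (n := p.2))
    exact ⟨d, hd, hlt⟩
  choose d hd hlt using happ
  let code : {x : ∀ k, M.carrier (σ k) | ∀ k, x k ∈ closedHull D M s (σ k)} →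
      (Fin n × ℕ → skolemHull D M s) := fun x p => ⟨_, hd x p⟩
  have hcode : Function.Injective code := by
    intro x y hxy
    have hxy' : ∀ p, d x p = d y p := fun p =>
      eq_of_heq (Sigma.mk.inj (Subtype.ext_iff.1 (congrFun hxy p))).2
    refine Subtype.ext (funext fun k => eq_of_forall_dist_le fun ε hε => ?_)
    obtain ⟨r, hr⟩ := exists_nat_one_div_lt (half_pos hε)
    have h₁ := hlt x (k, r)
    have h₂ := hlt y (k, r)
    rw [← hxy'] at h₂
    have h₃ := dist_triangle_right (x.1 k) (y.1 k) (d x (k, r))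
    dsimp only at h₁ h₂
    linarith
  refine (Cardinal.mk_le_of_injective hcode).trans ?_
  rw [Cardinal.mk_pi, Cardinal.prod_const, Cardinal.lift_id'.{0, u}]
  refine (Cardinal.power_le_power_right hH).trans ?_
  refine (Cardinal.power_le_power_left Cardinal.continuum_ne_zero
    (c := ℵ₀) (by
      rw [← Cardinal.lift_aleph0.{u, 0}, Cardinal.lift_le]
      exact Cardinal.mk_le_aleph0)).trans ?_
  rw [Cardinal.continuum_power_aleph0]

theorem densityCharacter_restrict_closedHull_le (hT : Countable (Σ n : ℕ, Fin n → L.Sorts))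
    (hD : ∀ n σ, (D n σ).Countable) {s : Set (Σ S, M.carrier S)} (hs : #s ≤ 𝔠)
    (hc : ∀ S, IsClosed (closedHull D M s S)) (hw : HasWitnesses M (closedHull D M s)) :
    (M.restrict _ hc hw).densityCharacter ≤ 𝔠 := by
  refine ciSup_le' fun S => ?_
  let E : Set (closedHull D M s S) := {a | (⟨S, a.1⟩ : Σ S, M.carrier S) ∈ skolemHull D M s}
  have hE : Dense E := Subtype.dense_iff.2 (closure_mono
    fun b hb => ⟨⟨b, subset_closure hb⟩, hb, rfl⟩)
  refine (densityCharacter_le hE).trans ?_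
  have hinj : Function.Injective fun a : E => (⟨_, a.2⟩ : skolemHull D M s) := by
    intro a b hab
    exact Subtype.ext (Subtype.ext (eq_of_heq (Sigma.mk.inj (Subtype.ext_iff.1 hab)).2))
  exact (Cardinal.mk_le_of_injective hinj).trans
    ((card_skolemHull_le hT hD s).trans (max_le Cardinal.aleph0_le_continuum hs))

/-- If countable subsets of the index set are strictly bounded, the closed hull of the union of a
chain is the union of the closed hulls. -/
theorem exists_mem_closedHull_Iio {ι : Type} [LinearOrder ι] [Nonempty ι]
    (hι : ∀ f : ℕ → ι, ∃ i, ∀ k, f k < i) (c : ι → Set (Σ S, M.carrier S)) {n : ℕ}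
    {σ : Fin n → L.Sorts} {x : ∀ k, M.carrier (σ k)}
    (hx : ∀ k, x k ∈ closedHull D M (⋃ i, c i) (σ k)) :
    ∃ i, ∀ j, i ≤ j → ∀ k, x k ∈ closedHull D M (⋃ l ∈ Set.Iio j, c l) (σ k) := by
  have : NoMaxOrder ι := ⟨fun a => (hι fun _ => a).imp fun i h => h 0⟩
  have happ : ∀ p : Fin n × ℕ, ∃ i, ∃ d : M.carrier (σ p.1),
      (⟨σ p.1, d⟩ : Σ S, M.carrier S) ∈ skolemHull D M (⋃ l ∈ Set.Iio i, c l) ∧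
        dist (x p.1) d < 1 / (p.2 + 1 : ℝ) := fun p => by
    obtain ⟨d, hd, hlt⟩ := Metric.mem_closure_iff.1 (hx p.1) _
      (Nat.one_div_pos_of_nat (α := ℝ) (n := p.2))
    obtain ⟨i, hi⟩ := exists_mem_skolemHull_Iio c hd
    exact ⟨i, d, hi, hlt⟩
  choose t d hd hlt using happ
  obtain ⟨i, hi⟩ := hι fun k => ((Encodable.decode k : Option (Fin n × ℕ)).map t).getD
    (Classical.arbitrary ι)
  refine ⟨i, fun j hj k => Metric.mem_closure_iff.2 fun ε hε => ?_⟩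
  obtain ⟨r, hr⟩ := exists_nat_one_div_lt hε
  have h₁ : t (k, r) < i := by simpa using hi (Encodable.encode (k, r))
  exact ⟨d (k, r), skolemHull_mono (Set.biUnion_mono (Set.Iio_subset_Iio (h₁.le.trans hj))
    fun _ _ => subset_rfl) (hd (k, r)), (hlt (k, r)).trans hr⟩

end Hull

/-! ### Construction of models with a scale -/

/-- For every well-order of size at most `𝔠` in which countable sets are strictly bounded there is a
model of density character at most `𝔠` with a scale indexed by this order. Inside a model in which
families of size `𝔠` are bounded, each member of the scale is chosen as a bound of the closed
Skolem hull of its predecessors. -/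
theorem exists_model_isScale (hT : IsTheory T) (hsep : SeparableRelativeTo T)
    (hX : X.IsDefinable) (hne : ∀ M, (X.set M).Nonempty)
    (hbound : ∀ (M : Mod T) (n : ℕ) (a : Fin n → ∀ i, M.1.carrier (X.sorts i)),
      (∀ j, a j ∈ X.set M) → ∃ b ∈ X.set M, ∀ j, φ.eval M (pairEnv (a j) b) = 0)
    {ι : Type} [LinearOrder ι] [WellFoundedLT ι] [Nonempty ι]
    (hι : ∀ f : ℕ → ι, ∃ i, ∀ k, f k < i) (hcard : #ι ≤ 𝔠) :
    ∃ A : Mod T, A.1.densityCharacter ≤ 𝔠 ∧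
      ∃ c : ι → ∀ k, A.1.carrier (X.sorts k), IsScale φ A c := by
  have hcount := hsep.countable_sorts
  choose D hDc hDd using hsep.exists_countable_dense
  obtain ⟨M, hM⟩ := exists_model_bounding hT hX hne hbound ℝ
  have hM' : ∀ H : Set (∀ k, M.1.carrier (X.sorts k)), #H ≤ 𝔠 →
      ∃ b : X.set M, ∀ x ∈ X.set M, x ∈ H → φ.eval M (pairEnv x b) = 0 := by
    intro H hH
    let H' : Set (X.set M) := {x | x.1 ∈ H}
    have hH' : Cardinal.lift.{0} #H' ≤ Cardinal.lift.{u} #ℝ := by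
      rw [Cardinal.mk_real, Cardinal.lift_continuum, Cardinal.lift_id'.{0, u}]
      refine le_trans (Cardinal.mk_le_of_injective (f := fun x : H' => (⟨_, x.2⟩ : H)) ?_) hH
      intro x y hxy
      exact Subtype.ext (Subtype.ext (congrArg (fun z : H => z.1) hxy))
    obtain ⟨e⟩ := Cardinal.lift_mk_le'.1 hH'
    obtain ⟨b, hb, hle⟩ := hM (Function.extend e (↑) fun _ => ⟨_, (hne M).some_mem⟩)
    refine ⟨⟨b, hb⟩, fun x hx hxH => ?_⟩
    have h := hle (e ⟨⟨x, hx⟩, hxH⟩)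
    rwa [e.injective.extend_apply] at h
  let G : ∀ i : ι, (Set.Iio i → X.set M) → Set (Σ S, M.1.carrier S) :=
    fun i g => ⋃ j, tuplePoints (g j).1
  obtain ⟨c, hc⟩ := exists_forall_of_forall_exists
    (fun (i : ι) (g : Set.Iio i → X.set M) (b : X.set M) => ∀ x ∈ X.set M,
      (∀ k, x k ∈ closedHull D M.1 (G i g) (X.sorts k)) → φ.eval M (pairEnv x b) = 0)
    (fun i g => hM' _ (card_tuples_closedHull_le hcount hDc (card_iUnion_tuplePoints_le
      ((Cardinal.mk_set_le _).trans hcard) fun j => (g j).1) X.sorts))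
  let s : Set (Σ S, M.1.carrier S) := ⋃ i, tuplePoints (c i).1
  have hw : HasWitnesses M.1 (closedHull D M.1 s) := hasWitnesses_closedHull hDd M s
  have hcl : ∀ S, IsClosed (closedHull D M.1 s S) := fun S => isClosed_closure
  let A : Mod T := ⟨M.1.restrict _ hcl hw, models_restrict hcl hw M.2⟩
  let ρ : Embedding A.1 M.1 := restrictEmbedding hcl hw
  have hρ : ∀ {α : Type} [Finite α] (σ : α → L.Sorts), ρ.TarskiVaught σ := fun σ =>
    restrictEmbedding_tarskiVaught hcl hw σ
  let cA : ι → ∀ k, A.1.carrier (X.sorts k) := fun i k =>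
    ⟨(c i).1 k, subset_closure (subset_skolemHull _ (Set.mem_iUnion.2 ⟨i, k, rfl⟩))⟩
  refine ⟨A, densityCharacter_restrict_closedHull_le hcount hDc
    (card_iUnion_tuplePoints_le hcard _) hcl hw, cA, fun i => ?_, fun x hx => ?_⟩
  · exact (hX.mem_comp_iff hne (hρ _) (cA i)).1 (c i).2
  · obtain ⟨i, hi⟩ := exists_mem_closedHull_Iio hι (fun i => tuplePoints (c i).1)
      (fun k => (x k).2)
    refine ⟨i, fun j hj => ?_⟩
    have hx' := (hX.mem_comp_iff hne (hρ _) x).2 hx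
    have h := hc j _ hx' (by
      have h := hi j hj
      rwa [Set.biUnion_eq_iUnion] at h)
    rw [(hρ _).predicate_eval_eq φ, ← pairEnv_comp]
    exact h

end DefinableSets

theorem exists_forall_lt_of_isRegular {c : Cardinal.{0}} (hc : c.IsRegular) {κ : Type}
    (hκ : #κ < c) (f : κ → c.ord.ToType) : ∃ i, ∀ k, f k < i := by
  have h : ¬ IsCofinal (Set.range f) := fun h => by
    have h₁ := (Order.cof_le h).trans Cardinal.mk_range_le
    rw [Ordinal.cof_toType, hc.cof_ord] at h₁
    exact h₁.not_gt hκ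
  obtain ⟨i, hi⟩ := not_isCofinal_iff.1 h
  exact ⟨i, fun k => hi _ ⟨k, rfl⟩⟩

end MetricLanguage

end

theorem theorem5p1 (L : MetricLanguage.{u}) (T : Set L.Sentence)
    (hT : MetricLanguage.IsTheory T)
    (hcomplete : MetricLanguage.IsComplete T)
    (hsep : MetricLanguage.SeparableRelativeTo T)
    (X : MetricLanguage.UniformAssignment T) (hX : X.IsDefinable)
    (φ : MetricLanguage.DefinablePredicate T (Sum.elim X.sorts X.sorts))
    (hdiscrete : ∀ M : MetricLanguage.Mod T, ∀ a ∈ X.set M, ∀ b ∈ X.set M,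
      φ.eval M (MetricLanguage.pairEnv a b) = 0 ∨ φ.eval M (MetricLanguage.pairEnv a b) = 1)
    (hasymm : ∀ M : MetricLanguage.Mod T, ∀ a ∈ X.set M, ∀ b ∈ X.set M,
      φ.eval M (MetricLanguage.pairEnv a b) = 0 → φ.eval M (MetricLanguage.pairEnv b a) = 1)
    (hbound : ∀ (M : MetricLanguage.Mod T) (n : ℕ) (a : Fin n → ∀ i, M.1.carrier (X.sorts i)),
      (∀ j, a j ∈ X.set M) →
        ∃ b ∈ X.set M, ∀ j, φ.eval M (MetricLanguage.pairEnv (a j) b) = 0)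
    (hCH : (𝔠 : Cardinal.{0}) ≠ ℵ₁) :
    ∃ A B : MetricLanguage.Mod T,
      A.1.densityCharacter ≤ (𝔠 : Cardinal.{u}) ∧ B.1.densityCharacter ≤ (𝔠 : Cardinal.{u}) ∧
        ∀ U V : Ultrafilter ℕ, MetricLanguage.Nonprincipal U → MetricLanguage.Nonprincipal V →
          ¬ MetricLanguage.Isomorphic (A.1.ultrapower U) (B.1.ultrapower V) := by
  have hne : ∀ M, (X.set M).Nonempty := fun M => by
    obtain ⟨b, hb, -⟩ := hbound M 0 Fin.elim0 fun j => j.elim0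
    exact ⟨b, hb⟩
  have hℵ₁ : (ℵ₁ : Cardinal.{0}).IsRegular := Cardinal.isRegular_aleph_one
  have hℵ₂ : (Order.succ ℵ₁ : Cardinal.{0}).IsRegular := Cardinal.isRegular_succ hℵ₁.aleph0_le
  have hle : Order.succ ℵ₁ ≤ (𝔠 : Cardinal.{0}) :=
    Order.succ_le_of_lt (Cardinal.aleph_one_le_continuum.lt_of_ne hCH.symm)
  have hlt₁ : #ℕ < (ℵ₁ : Cardinal.{0}) := by
    rw [Cardinal.mk_nat]; exact Cardinal.aleph0_lt_aleph_one
  have hlt₂ : #ℕ < (Order.succ ℵ₁ : Cardinal.{0}) := hlt₁.trans (Order.lt_succ _)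
  -- The bound of the empty family shows that the index orders are nonempty.
  have : Nonempty (ℵ₁ : Cardinal.{0}).ord.ToType :=
    (MetricLanguage.exists_forall_lt_of_isRegular hℵ₁ (κ := Empty) (by simp)
      Empty.elim).nonempty
  have : Nonempty (Order.succ ℵ₁ : Cardinal.{0}).ord.ToType :=
    (MetricLanguage.exists_forall_lt_of_isRegular hℵ₂ (κ := Empty) (by simpa using hℵ₂.pos)
      Empty.elim).nonempty
  have hb₁ := fun f => MetricLanguage.exists_forall_lt_of_isRegular hℵ₁ hlt₁ f
  have hb₂ := fun f => MetricLanguage.exists_forall_lt_of_isRegular hℵ₂ hlt₂ f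
  obtain ⟨A, hA, c, hc⟩ := MetricLanguage.exists_model_isScale hT hsep hX hne hbound hb₁
    (by rw [Cardinal.mk_toType, Cardinal.card_ord]; exact Cardinal.aleph_one_le_continuum)
  obtain ⟨B, hB, d, hd⟩ := MetricLanguage.exists_model_isScale hT hsep hX hne hbound hb₂
    (by rw [Cardinal.mk_toType, Cardinal.card_ord]; exact hle)
  refine ⟨A, B, hA, hB, fun U V _ _ => ?_⟩
  exact MetricLanguage.IsScale.not_isomorphic hX hne hasymm (hc.ultrapower hX hne hb₁ U)
    (hd.ultrapower hX hne hb₂ V) fun f => MetricLanguage.exists_forall_lt_of_isRegular hℵ₂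
      (by rw [Cardinal.mk_toType, Cardinal.card_ord]; exact Order.lt_succ _) f
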